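/- Let $k$ be an algebraically closed field; all algebras are commutative. (1) Let $H$ be a commutative Hopf algebra over $k$, not necessarily of finite type. An $H$-Galois extension of $k$ is a non-zero commutative right $H$-comodule algebra $A=(A,\rho_A)$ (that is, $\rho_A\colon A\to A\otimes_k H$ is a coassociative and counital algebra map) such that $$A\otimes_k A\longrightarrow A\otimes_k H,\qquad a\otimes b\longmapsto a\,\rho_A(b),$$ is an isomorphism. Every $H$-Galois extension $A$ of $k$ is trivial, i.e., it is isomorphic as a right $H$-comodule algebra to $H$ with its comultiplication $\Delta_H\colon H\to H\otimes_k H$ as coaction. (2) In geometric terms, let $G$ be an affine group scheme over $k$, not necessarily of finite type. A $G$-torsor is a non-empty $k$-scheme $X$ (not assumed to be affine) with a right $G$-action such that $X\times_k G\to X\times_k X$, $(x,g)\mapsto(x,xg)$, is an isomorphism. Every $G$-torsor is trivial, i.e., $G$-equivariantly isomorphic over $k$ to $G$ acting on itself by right multiplication. -/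

import Mathlib

universe u v w w'

open scoped TensorProduct

/-- A right `H`-comodule algebra structure on the commutative `k`-algebra `A`: a right coaction
`ρ : A → A ⊗ H`, coassociative and counital, that is an algebra map. -/
structure ComoduleAlgebra (k : Type u) (H : Type v) (A : Type w) [CommRing k]
    [CommRing H] [Bialgebra k H] [CommRing A] [Algebra k A] where
  /-- The structure map `ρ : A → A ⊗ H`. -/
  coact : A →ₐ[k] A ⊗[k] H
  /-- `(ρ ⊗ id) ∘ ρ = (id ⊗ Δ) ∘ ρ`. -/
  coassoc : ∀ a : A,
    Algebra.TensorProduct.assoc k k k A H H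
        (Algebra.TensorProduct.map coact (AlgHom.id k H) (coact a)) =
      Algebra.TensorProduct.map (AlgHom.id k A) (Bialgebra.comulAlgHom k H) (coact a)
  /-- `(id ⊗ ε) ∘ ρ = id`. -/
  counit : ∀ a : A,
    Algebra.TensorProduct.rid k k A
        (Algebra.TensorProduct.map (AlgHom.id k A) (Bialgebra.counitAlgHom k H) (coact a)) = a

namespace ComoduleAlgebra

variable {k : Type u} {H : Type v} {A : Type w} {B : Type w'} [CommRing k]
  [CommRing H] [Bialgebra k H] [CommRing A] [Algebra k A] [CommRing B] [Algebra k B]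

variable (k H) in
/-- `H` as a right comodule algebra over itself, through its comultiplication. -/
noncomputable def regular : ComoduleAlgebra k H H where
  coact := Bialgebra.comulAlgHom k H
  coassoc := Coalgebra.coassoc_apply
  counit a := by
    have h : Algebra.TensorProduct.map (AlgHom.id k H) (Bialgebra.counitAlgHom k H)
        (Bialgebra.comulAlgHom k H a) = a ⊗ₜ[k] (1 : k) :=
      Coalgebra.lTensor_counit_comul a
    rw [h]
    simp

/-- The `A`-linear extension `A ⊗ A → A ⊗ H`, `a ⊗ b ↦ a ρ(b)`, of the coaction. -/
noncomputable def galoisMap (ρ : ComoduleAlgebra k H A) : A ⊗[k] A →ₐ[k] A ⊗[k] H :=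
  Algebra.TensorProduct.productMap Algebra.TensorProduct.includeLeft ρ.coact

/-- `A` is an `H`-Galois extension of the base `k`: it is non-zero, and the map
`A ⊗ A → A ⊗ H`, `a ⊗ b ↦ a ρ(b)`, is bijective. -/
structure IsGaloisExtension (ρ : ComoduleAlgebra k H A) : Prop where
  nontrivial : Nontrivial A
  bijective : Function.Bijective ρ.galoisMap

/-- An isomorphism of right `H`-comodule algebras: an algebra isomorphism `e` that is
`H`-colinear, `ρ_B ∘ e = (e ⊗ id) ∘ ρ_A`. -/
structure Iso (ρA : ComoduleAlgebra k H A) (ρB : ComoduleAlgebra k H B) where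
  toAlgEquiv : A ≃ₐ[k] B
  colinear : ∀ a : A, ρB.coact (toAlgEquiv a) =
    Algebra.TensorProduct.map (toAlgEquiv : A →ₐ[k] B) (AlgHom.id k H) (ρA.coact a)

end ComoduleAlgebra

open CategoryTheory MonoidalCategory CartesianMonoidalCategory

/-- A right action of the monoid object `G` on the object `X`. -/
structure RightActionObj {C : Type u} [Category.{v} C] [CartesianMonoidalCategory C]
    (G : C) [MonObj G] (X : C) where
  /-- The action map `(x, g) ↦ x g`. -/
  act : X ⊗ G ⟶ X
  /-- `x 1 = x`. -/
  act_one : X ◁ MonObj.one ≫ act = (ρ_ X).hom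
  /-- `(x g) h = x (g h)`. -/
  act_mul : act ▷ G ≫ act = (α_ X G G).hom ≫ X ◁ MonObj.mul ≫ act

namespace RightActionObj

variable {C : Type u} [Category.{v} C] [CartesianMonoidalCategory C] {G : C} [MonObj G]

variable (G) in
/-- `G` acting on itself by right multiplication. -/
def regular : RightActionObj G G where
  act := MonObj.mul
  act_one := MonObj.mul_one G
  act_mul := MonObj.mul_assoc G

/-- The map `X × G → X × X`, `(x, g) ↦ (x, x g)`. -/
def shear {X : C} (a : RightActionObj G X) : X ⊗ G ⟶ X ⊗ X := lift (fst X G) a.act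

/-- A `G`-equivariant isomorphism. -/
structure Iso {X Y : C} (a : RightActionObj G X) (b : RightActionObj G Y) where
  toIso : X ≅ Y
  equivariant : a.act ≫ toIso.hom = toIso.hom ▷ G ≫ b.act

end RightActionObj

/-- The `k`-scheme `X`, with its right action of the group scheme `G` over the field `k`, is a
`G`-torsor: `X` is non-empty and `X × G → X × X`, `(x, g) ↦ (x, x g)`, is an isomorphism.
(Since `k` is a field, a non-empty `X` is faithfully flat over `k` and has a point over some
extension field of `k`, so that it is locally isomorphic to `G`.) -/
structure IsTorsor {k : Type u} [Field k] {G : Over (AlgebraicGeometry.Spec (CommRingCat.of k))}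
    [GrpObj G] {X : Over (AlgebraicGeometry.Spec (CommRingCat.of k))}
    (a : RightActionObj G X) : Prop where
  nonempty : Nonempty X.left
  isIso_shear : IsIso a.shear

/-!
A torsor with a rational point is trivial: the orbit map of the point is an equivariant isomorphism.
So everything rests on finding a `k`-point of `X = Spec A`.

For a Hopf subalgebra `K` of `H` put `A_K = {a | ρ(a) ∈ A ⊗ K}`. The translation map `H → A ⊗ A`,
`h ↦ γ⁻¹(1 ⊗ h)` for the Galois map `γ`, carries `K` into `A_K ⊗ A_K`, so `A_K` is a Galois
extension for `K`, and it is of finite type when `K` is. By Zorn's lemma there is a maximal `K` for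
which a point `x` of `A_K` has been chosen. If `F` is a finitely generated Hopf subalgebra, then
`A_{KF}` is generated by `A_K` and the finitely generated algebra `A_F`, so by the Nullstellensatz
`x` extends to `A_{KF}` as soon as `ker x` does not generate the unit ideal of `A`. That condition
involves only finitely many elements, and so reduces to lifting points along `A_K → A_L` for
finitely generated `K ≤ L`. Such points can be lifted because a dominant homomorphism of algebraic
groups is surjective on `k`-points: its image contains a dense open `U`, and every point is a
quotient of two points of `U`.

In the geometric case, `X` becomes isomorphic to a base change of `G`, hence affine, after the
faithfully flat base change to an affine open subscheme of `X`. So `X` is affine by descent, and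
the action is a coaction.
-/

section Points

open WithConv

variable {k H K R S : Type*} [CommRing k] [CommRing H] [CommRing K] [CommRing R] [Algebra k R]
  [CommRing S] [Algebra k S]

/-- The map `G(R) → G(S)` on points of the affine monoid scheme `G = Spec H` induced by `R → S`. -/
noncomputable def pointMap (H : Type*) [CommRing H] [Bialgebra k H] (f : R →ₐ[k] S) :
    WithConv (H →ₐ[k] R) →* WithConv (H →ₐ[k] S) where
  toFun g := toConv (f.comp g.ofConv)
  map_one' := by
    ext h
    exact f.commutes _
  map_mul' g g' := congrArg toConv (AlgHom.comp_convMul_distrib f g g')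

/-- The map `G(R) → Q(R)` on points of affine monoid schemes induced by a homomorphism from
`G = Spec H` to `Q = Spec K`. -/
noncomputable def pointComap (R : Type*) [CommRing R] [Algebra k R] [Bialgebra k H]
    [Bialgebra k K] (φ : K →ₐc[k] H) : WithConv (H →ₐ[k] R) →* WithConv (K →ₐ[k] R) where
  toFun g := toConv (g.ofConv.comp φ)
  map_one' := by
    ext h
    exact congrArg (algebraMap k R) (CoalgHomClass.counit_comp_apply φ h)
  map_mul' g g' := congrArg toConv (AlgHom.convMul_comp_bialgHom_distrib g g' φ)

theorem toConv_comulAlgHom [Bialgebra k H] :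
    toConv (Bialgebra.comulAlgHom k H) =
      toConv (Algebra.TensorProduct.includeLeft : H →ₐ[k] H ⊗[k] H) *
        toConv Algebra.TensorProduct.includeRight := by
  ext h
  rw [AlgHom.convMul_apply]
  exact (DFunLike.congr_fun (Algebra.TensorProduct.lift_includeLeft_includeRight) _).symm

theorem pointMap_injective [Bialgebra k H] {f : R →ₐ[k] S} (hf : Function.Injective f) :
    Function.Injective (pointMap H f) := fun _ _ h =>
  ofConv_injective ((AlgHom.cancel_left hf).1 (toConv_injective h))

variable [HopfAlgebra k H]

theorem toConv_mul_toConv_comp_antipodeAlgHom (f : H →ₐ[k] R) :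
    toConv f * toConv (f.comp (HopfAlgebra.antipodeAlgHom k H)) = 1 :=
  calc toConv f * toConv (f.comp (HopfAlgebra.antipodeAlgHom k H))
      = pointMap H f (toConv (.id k H)) * pointMap H f (toConv (.id k H))⁻¹ := rfl
    _ = 1 := by rw [← map_mul, mul_inv_cancel, map_one]

theorem antipodeAlgHom_comp_antipodeAlgHom :
    (HopfAlgebra.antipodeAlgHom k H).comp (HopfAlgebra.antipodeAlgHom k H) = AlgHom.id k H :=
  toConv_injective (inv_inv (toConv (AlgHom.id k H)))

theorem comulAlgHom_comp_antipodeAlgHom :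
    (Bialgebra.comulAlgHom k H).comp (HopfAlgebra.antipodeAlgHom k H) =
      ((Algebra.TensorProduct.map (HopfAlgebra.antipodeAlgHom k H)
        (HopfAlgebra.antipodeAlgHom k H)).comp
        (Algebra.TensorProduct.comm k H H).toAlgHom).comp (Bialgebra.comulAlgHom k H) := by
  set f := (Algebra.TensorProduct.map (HopfAlgebra.antipodeAlgHom k H)
    (HopfAlgebra.antipodeAlgHom k H)).comp (Algebra.TensorProduct.comm k H H).toAlgHom with hf
  have f_includeLeft : pointMap H f (toConv Algebra.TensorProduct.includeLeft) =
      (toConv Algebra.TensorProduct.includeRight)⁻¹ := by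
    ext h
    change f (h ⊗ₜ 1) = 1 ⊗ₜ HopfAlgebra.antipode k h
    simp [hf]
  have f_includeRight : pointMap H f (toConv Algebra.TensorProduct.includeRight) =
      (toConv Algebra.TensorProduct.includeLeft)⁻¹ := by
    ext h
    change f (1 ⊗ₜ h) = HopfAlgebra.antipode k h ⊗ₜ 1
    simp [hf]
  apply toConv_injective
  calc toConv ((Bialgebra.comulAlgHom k H).comp (HopfAlgebra.antipodeAlgHom k H))
      = (toConv (Bialgebra.comulAlgHom k H))⁻¹ := rfl
    _ = pointMap H f (toConv (Bialgebra.comulAlgHom k H)) := by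
      rw [toConv_comulAlgHom, map_mul, f_includeLeft, f_includeRight]
      exact mul_inv_rev (toConv (Algebra.TensorProduct.includeLeft : H →ₐ[k] H ⊗[k] H))
        (toConv Algebra.TensorProduct.includeRight)

end Points

section Slices

variable {k M N M' N' : Type*} [CommRing k] [AddCommGroup M] [Module k M] [AddCommGroup N]
  [Module k N] [AddCommGroup M'] [Module k M'] [AddCommGroup N'] [Module k N']

/-- The slice map `id ⊗ ψ : M ⊗ N → M` of a linear form `ψ` on `N`. -/
noncomputable def sliceRight (ψ : N →ₗ[k] k) : M ⊗[k] N →ₗ[k] M :=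
  TensorProduct.rid k M ∘ₗ ψ.lTensor M

/-- The slice map `φ ⊗ id : M ⊗ N → N` of a linear form `φ` on `M`. -/
noncomputable def sliceLeft (φ : M →ₗ[k] k) : M ⊗[k] N →ₗ[k] N :=
  TensorProduct.lid k N ∘ₗ φ.rTensor N

@[simp]
theorem sliceRight_tmul (ψ : N →ₗ[k] k) (m : M) (n : N) : sliceRight ψ (m ⊗ₜ[k] n) = ψ n • m := by
  simp [sliceRight]

@[simp]
theorem sliceLeft_tmul (φ : M →ₗ[k] k) (m : M) (n : N) : sliceLeft φ (m ⊗ₜ[k] n) = φ m • n := by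
  simp [sliceLeft]

theorem sliceRight_map (ψ : N' →ₗ[k] k) (f : M →ₗ[k] M') (g : N →ₗ[k] N') (x : M ⊗[k] N) :
    sliceRight ψ (TensorProduct.map f g x) = f (sliceRight (ψ ∘ₗ g) x) := by
  induction x with
  | zero => simp
  | tmul m n => simp
  | add x y hx hy => simp only [map_add, hx, hy]

theorem sliceLeft_map (φ : M' →ₗ[k] k) (f : M →ₗ[k] M') (g : N →ₗ[k] N') (x : M ⊗[k] N) :
    sliceLeft φ (TensorProduct.map f g x) = g (sliceLeft (φ ∘ₗ f) x) := by
  induction x with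
  | zero => simp
  | tmul m n => simp
  | add x y hx hy => simp only [map_add, hx, hy]

theorem sliceRight_comm (φ : M →ₗ[k] k) (x : M ⊗[k] N) :
    sliceRight φ (TensorProduct.comm k M N x) = sliceLeft φ x := by
  induction x with
  | zero => simp
  | tmul m n => simp
  | add x y hx hy => simp only [map_add, hx, hy]

theorem eq_of_forall_sliceRight_eq [Module.Free k N] {x y : M ⊗[k] N}
    (hxy : ∀ ψ : N →ₗ[k] k, sliceRight ψ x = sliceRight ψ y) : x = y := by
  classical
  let b := Module.Free.chooseBasis k N
  have coord_eq (z : M ⊗[k] N) (i) :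
      TensorProduct.equivFinsuppOfBasisRight b z i = sliceRight (b.coord i) z := by
    induction z with
    | zero => simp
    | tmul m n => simp
    | add z w hz hw => simp only [map_add, Finsupp.add_apply, hz, hw]
  refine (TensorProduct.equivFinsuppOfBasisRight b).injective (Finsupp.ext fun i => ?_)
  rw [coord_eq, coord_eq, hxy]

theorem eq_of_forall_sliceLeft_eq [Module.Free k M] {x y : M ⊗[k] N}
    (hxy : ∀ φ : M →ₗ[k] k, sliceLeft φ x = sliceLeft φ y) : x = y := by
  refine (TensorProduct.comm k M N).injective (eq_of_forall_sliceRight_eq fun φ => ?_)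
  rw [sliceRight_comm, sliceRight_comm, hxy]

end Slices

section TensorOfSubspaces

variable {k M N : Type*} [Field k] [AddCommGroup M] [Module k M] [AddCommGroup N] [Module k N]

theorem mem_range_mapIncl_iff_forall_slice_mem {V : Submodule k M} {W : Submodule k N}
    {x : M ⊗[k] N} :
    x ∈ LinearMap.range (TensorProduct.mapIncl V W) ↔
      (∀ ψ : N →ₗ[k] k, sliceRight ψ x ∈ V) ∧ ∀ φ : M →ₗ[k] k, sliceLeft φ x ∈ W := by
  constructor
  · rintro ⟨y, rfl⟩
    refine ⟨fun ψ => ?_, fun φ => ?_⟩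
    · rw [TensorProduct.mapIncl, sliceRight_map]
      exact Subtype.prop _
    · rw [TensorProduct.mapIncl, sliceLeft_map]
      exact Subtype.prop _
  · rintro ⟨sliceRight_mem, sliceLeft_mem⟩
    obtain ⟨p, hp⟩ := V.subtype.exists_leftInverse_of_injective V.ker_subtype
    obtain ⟨q, hq⟩ := W.subtype.exists_leftInverse_of_injective W.ker_subtype
    have p_eq {m : M} (hm : m ∈ V) : (p m : M) = m :=
      congrArg Subtype.val (LinearMap.congr_fun hp ⟨m, hm⟩)
    have q_eq {n : N} (hn : n ∈ W) : (q n : N) = n :=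
      congrArg Subtype.val (LinearMap.congr_fun hq ⟨n, hn⟩)
    have fixed_left : TensorProduct.map (V.subtype ∘ₗ p) LinearMap.id x = x :=
      eq_of_forall_sliceRight_eq fun ψ => (sliceRight_map ψ _ _ x).trans (p_eq (sliceRight_mem ψ))
    have fixed_right : TensorProduct.map LinearMap.id (W.subtype ∘ₗ q) x = x :=
      eq_of_forall_sliceLeft_eq fun φ => (sliceLeft_map φ _ _ x).trans (q_eq (sliceLeft_mem φ))
    refine ⟨TensorProduct.map p q x, ?_⟩
    calc TensorProduct.mapIncl V W (TensorProduct.map p q x)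
        = TensorProduct.map (V.subtype ∘ₗ p) LinearMap.id
            (TensorProduct.map LinearMap.id (W.subtype ∘ₗ q) x) := by
          simp only [TensorProduct.mapIncl, ← LinearMap.comp_apply, ← TensorProduct.map_comp,
            LinearMap.comp_id, LinearMap.id_comp]
      _ = x := by rw [fixed_right, fixed_left]

end TensorOfSubspaces

section TensorOfSubalgebras

variable {k A B : Type*} [Field k] [CommRing A] [Algebra k A] [CommRing B] [Algebra k B]
  {K K' : Subalgebra k A} {L L' : Subalgebra k B}

/-- The subalgebra `K ⊗ L` of `A ⊗ B`. -/
noncomputable def tensorSubalgebra (K : Subalgebra k A) (L : Subalgebra k B) :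
    Subalgebra k (A ⊗[k] B) :=
  (Algebra.TensorProduct.map K.val L.val).range

theorem mem_tensorSubalgebra_iff {x : A ⊗[k] B} :
    x ∈ tensorSubalgebra K L ↔
      (∀ ψ : B →ₗ[k] k, sliceRight ψ x ∈ K) ∧ ∀ φ : A →ₗ[k] k, sliceLeft φ x ∈ L :=
  mem_range_mapIncl_iff_forall_slice_mem (V := Subalgebra.toSubmodule K)
    (W := Subalgebra.toSubmodule L)

theorem mem_top_tensorSubalgebra_iff {x : A ⊗[k] B} :
    x ∈ tensorSubalgebra ⊤ L ↔ ∀ φ : A →ₗ[k] k, sliceLeft φ x ∈ L := by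
  simp [mem_tensorSubalgebra_iff]

theorem tmul_mem_tensorSubalgebra {a : A} {b : B} (ha : a ∈ K) (hb : b ∈ L) :
    a ⊗ₜ[k] b ∈ tensorSubalgebra K L :=
  ⟨(⟨a, ha⟩ : K) ⊗ₜ (⟨b, hb⟩ : L), rfl⟩

theorem tensorSubalgebra_mono (hK : K ≤ K') (hL : L ≤ L') :
    tensorSubalgebra K L ≤ tensorSubalgebra K' L' := fun _ hx =>
  mem_tensorSubalgebra_iff.2 ((mem_tensorSubalgebra_iff.1 hx).imp
    (fun h ψ => hK (h ψ)) (fun h φ => hL (h φ)))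

theorem tensorSubalgebra_le {T : Subalgebra k (A ⊗[k] B)} (hK : ∀ a ∈ K, a ⊗ₜ 1 ∈ T)
    (hL : ∀ b ∈ L, 1 ⊗ₜ b ∈ T) : tensorSubalgebra K L ≤ T := by
  rintro _ ⟨x, rfl⟩
  induction x with
  | zero => simp only [map_zero, zero_mem]
  | tmul a b => simpa using mul_mem (hK _ a.2) (hL _ b.2)
  | add x y hx hy => simpa only [map_add] using add_mem hx hy

theorem exists_finset_mem_tensorSubalgebra {x : A ⊗[k] B} (hx : x ∈ tensorSubalgebra K L) :
    ∃ t : Finset B, ↑t ⊆ (L : Set B) ∧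
      ∀ L' : Subalgebra k B, ↑t ⊆ (L' : Set B) → x ∈ tensorSubalgebra K L' := by
  classical
  obtain ⟨y, rfl⟩ := hx
  induction y with
  | zero => exact ⟨∅, by simp, fun L' _ => by simp⟩
  | tmul a b =>
    exact ⟨{(b : B)}, by simp, fun L' h => tmul_mem_tensorSubalgebra a.2 (by simpa using h)⟩
  | add y z hy hz =>
    obtain ⟨s, hs, hs'⟩ := hy
    obtain ⟨t, ht, ht'⟩ := hz
    refine ⟨s ∪ t, by simp [hs, ht], fun L' h => ?_⟩
    rw [Finset.coe_union, Set.union_subset_iff] at h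
    rw [map_add]
    exact add_mem (hs' L' h.1) (ht' L' h.2)

theorem map_val_val_injective (K : Subalgebra k A) (L : Subalgebra k B) :
    Function.Injective (Algebra.TensorProduct.map K.val L.val) :=
  TensorProduct.map_injective_of_flat_flat (Subalgebra.toSubmodule K).subtype
    (Subalgebra.toSubmodule L).subtype Subtype.val_injective Subtype.val_injective

variable {C : Type*} [CommRing C] [Algebra k C]

/-- A homomorphism into `A ⊗ B` with values in `K ⊗ L`, as a homomorphism into the abstract tensor
product of `K` and `L`. -/
noncomputable def codRestrictTensor (K : Subalgebra k A) (L : Subalgebra k B)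
    (f : C →ₐ[k] A ⊗[k] B) (hf : ∀ c, f c ∈ tensorSubalgebra K L) : C →ₐ[k] K ⊗[k] L :=
  (AlgEquiv.ofInjective _ (map_val_val_injective K L)).symm.toAlgHom.comp (f.codRestrict _ hf)

theorem map_val_val_codRestrictTensor (f : C →ₐ[k] A ⊗[k] B)
    (hf : ∀ c, f c ∈ tensorSubalgebra K L) (c : C) :
    Algebra.TensorProduct.map K.val L.val (codRestrictTensor K L f hf c) = f c :=
  congrArg Subtype.val ((AlgEquiv.ofInjective _ (map_val_val_injective K L)).apply_symm_apply
    (f.codRestrict _ hf c))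

end TensorOfSubalgebras

section PullbackAlongInjective

variable {k A H A' H' : Type*} [Field k] [CommRing A] [Algebra k A] [CommRing H] [Algebra k H]
  [CommRing A'] [Algebra k A'] [CommRing H'] [Algebra k H'] {f : A' →ₐ[k] A} {g : H' →ₐ[k] H}

theorem map_injective (hf : Function.Injective f) (hg : Function.Injective g) :
    Function.Injective (Algebra.TensorProduct.map f g) :=
  TensorProduct.map_injective_of_flat_flat f.toLinearMap g.toLinearMap hf hg

theorem coassoc_of_injective (hf : Function.Injective f) (hg : Function.Injective g)
    {ρ' : A' →ₐ[k] A' ⊗[k] H'} {ρ : A →ₐ[k] A ⊗[k] H}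
    (hρ : ∀ a, Algebra.TensorProduct.map f g (ρ' a) = ρ (f a))
    {δ' : H' →ₐ[k] H' ⊗[k] H'} {δ : H →ₐ[k] H ⊗[k] H}
    (hδ : ∀ h, Algebra.TensorProduct.map g g (δ' h) = δ (g h))
    (coassoc : ∀ a, Algebra.TensorProduct.assoc k k k A H H
      (Algebra.TensorProduct.map ρ (.id k H) (ρ a)) =
        Algebra.TensorProduct.map (.id k A) δ (ρ a)) (a : A') :
    Algebra.TensorProduct.assoc k k k A' H' H'
        (Algebra.TensorProduct.map ρ' (.id k H') (ρ' a)) =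
      Algebra.TensorProduct.map (.id k A') δ' (ρ' a) := by
  have left_side : (Algebra.TensorProduct.map f (Algebra.TensorProduct.map g g)).comp
      ((Algebra.TensorProduct.assoc k k k A' H' H').toAlgHom.comp
        (Algebra.TensorProduct.map ρ' (.id k H'))) =
      ((Algebra.TensorProduct.assoc k k k A H H).toAlgHom.comp
        (Algebra.TensorProduct.map ρ (.id k H))).comp (Algebra.TensorProduct.map f g) := by
    have assoc_natural : (Algebra.TensorProduct.map f (Algebra.TensorProduct.map g g)).comp
        (Algebra.TensorProduct.assoc k k k A' H' H').toAlgHom =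
        (Algebra.TensorProduct.assoc k k k A H H).toAlgHom.comp
          (Algebra.TensorProduct.map (Algebra.TensorProduct.map f g) g) := by
      ext <;> rfl
    rw [← AlgHom.comp_assoc, assoc_natural]
    ext x
    · simp [hρ]
    · simp
  have right_side : (Algebra.TensorProduct.map f (Algebra.TensorProduct.map g g)).comp
      (Algebra.TensorProduct.map (.id k A') δ') =
      (Algebra.TensorProduct.map (.id k A) δ).comp (Algebra.TensorProduct.map f g) := by
    ext x
    · simp
    · simp [hδ]
  apply map_injective hf (map_injective hg hg)
  refine (DFunLike.congr_fun left_side (ρ' a)).trans (.trans ?_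
    (DFunLike.congr_fun right_side (ρ' a)).symm)
  simp only [AlgHom.comp_apply, hρ]
  exact coassoc (f a)

theorem rid_map_counit_of_injective (hf : Function.Injective f) {ρ' : A' →ₐ[k] A' ⊗[k] H'}
    {ρ : A →ₐ[k] A ⊗[k] H} (hρ : ∀ a, Algebra.TensorProduct.map f g (ρ' a) = ρ (f a))
    {ε : H →ₐ[k] k} (counit : ∀ a, Algebra.TensorProduct.rid k k A
      (Algebra.TensorProduct.map (.id k A) ε (ρ a)) = a) (a : A') :
    Algebra.TensorProduct.rid k k A'
      (Algebra.TensorProduct.map (.id k A') (ε.comp g) (ρ' a)) = a := by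
  have map_natural : f.comp ((Algebra.TensorProduct.rid k k A').toAlgHom.comp
      (Algebra.TensorProduct.map (.id k A') (ε.comp g))) =
      ((Algebra.TensorProduct.rid k k A).toAlgHom.comp
        (Algebra.TensorProduct.map (.id k A) ε)).comp (Algebra.TensorProduct.map f g) := by
    ext x <;> simp
  apply hf
  refine (DFunLike.congr_fun map_natural (ρ' a)).trans ?_
  simp only [AlgHom.comp_apply, hρ]
  exact counit (f a)

theorem lid_map_counit_of_injective (hf : Function.Injective f) {ρ' : A' →ₐ[k] H' ⊗[k] A'}
    {ρ : A →ₐ[k] H ⊗[k] A} (hρ : ∀ a, Algebra.TensorProduct.map g f (ρ' a) = ρ (f a))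
    {ε : H →ₐ[k] k} (counit : ∀ a, Algebra.TensorProduct.lid k A
      (Algebra.TensorProduct.map ε (.id k A) (ρ a)) = a) (a : A') :
    Algebra.TensorProduct.lid k A'
      (Algebra.TensorProduct.map (ε.comp g) (.id k A') (ρ' a)) = a := by
  have map_natural : f.comp ((Algebra.TensorProduct.lid k A').toAlgHom.comp
      (Algebra.TensorProduct.map (ε.comp g) (.id k A'))) =
      ((Algebra.TensorProduct.lid k A).toAlgHom.comp
        (Algebra.TensorProduct.map ε (.id k A))).comp (Algebra.TensorProduct.map g f) := by
    ext x <;> simp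
  apply hf
  refine (DFunLike.congr_fun map_natural (ρ' a)).trans ?_
  simp only [AlgHom.comp_apply, hρ]
  exact counit (f a)

end PullbackAlongInjective

section HopfSubalgebra

variable {k : Type u} {H : Type v} [Field k] [CommRing H] [HopfAlgebra k H]

/-- A Hopf subalgebra of a commutative Hopf algebra: a subalgebra closed under the comultiplication
and the antipode. It corresponds to a quotient of the affine group scheme `Spec H`. -/
class IsHopfSubalgebra (K : Subalgebra k H) : Prop where
  comul_mem : ∀ h ∈ K, Bialgebra.comulAlgHom k H h ∈ tensorSubalgebra K K
  antipode_mem : ∀ h ∈ K, HopfAlgebra.antipodeAlgHom k H h ∈ K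

namespace IsHopfSubalgebra

protected theorem sSup {S : Set (Subalgebra k H)} (hS : ∀ K ∈ S, IsHopfSubalgebra K) :
    IsHopfSubalgebra (sSup S) where
  comul_mem := by
    suffices sSup S ≤ (tensorSubalgebra (sSup S) (sSup S)).comap (Bialgebra.comulAlgHom k H) from
      this
    exact sSup_le fun K hK h hh => tensorSubalgebra_mono (le_sSup hK) (le_sSup hK)
      ((hS K hK).comul_mem h hh)
  antipode_mem := by
    suffices sSup S ≤ (sSup S).comap (HopfAlgebra.antipodeAlgHom k H) from this
    exact sSup_le fun K hK h hh => le_sSup hK ((hS K hK).antipode_mem h hh)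

instance sup (K L : Subalgebra k H) [hK : IsHopfSubalgebra K] [hL : IsHopfSubalgebra L] :
    IsHopfSubalgebra (K ⊔ L) := by
  rw [← sSup_pair]
  exact IsHopfSubalgebra.sSup (by rintro M (rfl | rfl) <;> assumption)

instance bot : IsHopfSubalgebra (⊥ : Subalgebra k H) := by
  simpa using IsHopfSubalgebra.sSup (S := (∅ : Set (Subalgebra k H))) (by simp)

instance top : IsHopfSubalgebra (⊤ : Subalgebra k H) where
  comul_mem _ _ := mem_top_tensorSubalgebra_iff.2 fun _ => trivial
  antipode_mem _ _ := trivial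

variable (K : Subalgebra k H) [IsHopfSubalgebra K]

/-- The comultiplication of a Hopf subalgebra. -/
noncomputable def comulRestrict : K →ₐ[k] K ⊗[k] K :=
  codRestrictTensor K K ((Bialgebra.comulAlgHom k H).comp K.val) fun h => comul_mem _ h.2

theorem map_val_val_comulRestrict (h : K) :
    Algebra.TensorProduct.map K.val K.val (comulRestrict K h) =
      Bialgebra.comulAlgHom k H (K.val h) :=
  map_val_val_codRestrictTensor _ _ h

theorem rTensor_counit_comulRestrict (h : K) :
    Algebra.TensorProduct.map ((Bialgebra.counitAlgHom k H).comp K.val) (.id k K)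
      (comulRestrict K h) = 1 ⊗ₜ h := by
  apply (Algebra.TensorProduct.lid k K).injective
  refine (lid_map_counit_of_injective (f := K.val) Subtype.val_injective
    (map_val_val_comulRestrict K) (fun x => ?_) h).trans (one_smul k h).symm
  exact (congrArg _ (Coalgebra.rTensor_counit_comul x)).trans (one_smul k x)

theorem lTensor_counit_comulRestrict (h : K) :
    Algebra.TensorProduct.map (.id k K) ((Bialgebra.counitAlgHom k H).comp K.val)
      (comulRestrict K h) = h ⊗ₜ 1 := by
  apply (Algebra.TensorProduct.rid k k K).injective
  exact (rid_map_counit_of_injective (f := K.val) Subtype.val_injective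
    (map_val_val_comulRestrict K) (ComoduleAlgebra.regular k H).counit h).trans (one_smul k h).symm

noncomputable instance : Bialgebra k K :=
  Bialgebra.ofAlgHom (comulRestrict K) ((Bialgebra.counitAlgHom k H).comp K.val)
    (AlgHom.ext (coassoc_of_injective (f := K.val) Subtype.val_injective Subtype.val_injective
      (map_val_val_comulRestrict K) (map_val_val_comulRestrict K)
      (ComoduleAlgebra.regular k H).coassoc))
    (AlgHom.ext (rTensor_counit_comulRestrict K)) (AlgHom.ext (lTensor_counit_comulRestrict K))

/-- The inclusion of a Hopf subalgebra, as a homomorphism of bialgebras. -/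
noncomputable def val : K →ₐc[k] H :=
  BialgHom.ofAlgHom K.val (by ext; rfl) (AlgHom.ext (map_val_val_comulRestrict K))

/-- The antipode of a Hopf subalgebra. -/
noncomputable def antipodeRestrict : K →ₐ[k] K :=
  ((HopfAlgebra.antipodeAlgHom k H).comp K.val).codRestrict K fun h => antipode_mem _ h.2

theorem toConv_antipodeRestrict_mul :
    WithConv.toConv (antipodeRestrict K) * WithConv.toConv (.id k K) = 1 := by
  apply pointMap_injective (f := K.val) Subtype.val_injective
  rw [map_mul, map_one]
  calc pointMap K K.val (WithConv.toConv (antipodeRestrict K)) *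
        pointMap K K.val (WithConv.toConv (.id k K))
      = pointComap H (val K) (WithConv.toConv (.id k H))⁻¹ *
          pointComap H (val K) (WithConv.toConv (.id k H)) := rfl
    _ = 1 := by rw [← map_mul, inv_mul_cancel, map_one]

theorem toConv_mul_antipodeRestrict :
    WithConv.toConv (.id k K) * WithConv.toConv (antipodeRestrict K) = 1 := by
  apply pointMap_injective (f := K.val) Subtype.val_injective
  rw [map_mul, map_one]
  calc pointMap K K.val (WithConv.toConv (.id k K)) *
        pointMap K K.val (WithConv.toConv (antipodeRestrict K))
      = pointComap H (val K) (WithConv.toConv (.id k H)) *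
          pointComap H (val K) (WithConv.toConv (.id k H))⁻¹ := rfl
    _ = 1 := by rw [← map_mul, mul_inv_cancel, map_one]

noncomputable instance : HopfAlgebra k K :=
  HopfAlgebra.ofAlgHom (antipodeRestrict K)
    (AlgHom.ext fun h => (AlgHom.convMul_apply _ _ h).symm.trans
      (DFunLike.congr_fun (congrArg WithConv.ofConv (toConv_antipodeRestrict_mul K)) h))
    (AlgHom.ext fun h => (AlgHom.convMul_apply _ _ h).symm.trans
      (DFunLike.congr_fun (congrArg WithConv.ofConv (toConv_mul_antipodeRestrict K)) h))

theorem counitAlgHom_comp_val :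
    (Bialgebra.counitAlgHom k H).comp K.val = Bialgebra.counitAlgHom k K := by
  ext
  rfl

theorem map_val_val_comulAlgHom (h : K) :
    Algebra.TensorProduct.map K.val K.val (Bialgebra.comulAlgHom k K h) =
      Bialgebra.comulAlgHom k H (K.val h) :=
  map_val_val_comulRestrict K h

variable {K} {L : Subalgebra k H} [IsHopfSubalgebra L]

/-- The inclusion of Hopf subalgebras, as a homomorphism of bialgebras. -/
noncomputable def inclusion (hKL : K ≤ L) : K →ₐc[k] L :=
  BialgHom.ofAlgHom (Subalgebra.inclusion hKL) (by ext; rfl) <| by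
    have val_comp_inclusion : (Algebra.TensorProduct.map L.val L.val).comp
        (Algebra.TensorProduct.map (Subalgebra.inclusion hKL) (Subalgebra.inclusion hKL)) =
        Algebra.TensorProduct.map K.val K.val := by
      ext <;> rfl
    ext h
    apply map_val_val_injective L L
    exact (DFunLike.congr_fun val_comp_inclusion (comulRestrict K h)).trans
      ((map_val_val_comulRestrict K h).trans
        (map_val_val_comulRestrict L (Subalgebra.inclusion hKL h)).symm)

end IsHopfSubalgebra

end HopfSubalgebra

section Actions

variable {k M N P C : Type*} [CommRing k] [AddCommGroup M] [Module k M] [AddCommGroup N]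
  [Module k N] [AddCommGroup P] [Module k P]

theorem exists_fg_forall_sliceLeft_mem (x : M ⊗[k] N) :
    ∃ W : Submodule k N, W.FG ∧ ∀ φ : M →ₗ[k] k, sliceLeft φ x ∈ W := by
  induction x with
  | zero => exact ⟨⊥, Submodule.fg_bot, fun φ => by simp⟩
  | tmul m n =>
    refine ⟨k ∙ n, Submodule.fg_span_singleton n, fun φ => ?_⟩
    rw [sliceLeft_tmul]
    exact Submodule.smul_mem _ _ (Submodule.mem_span_singleton_self n)
  | add x y hx hy =>
    obtain ⟨V, hV, hxV⟩ := hx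
    obtain ⟨W, hW, hyW⟩ := hy
    refine ⟨V ⊔ W, hV.sup hW, fun φ => ?_⟩
    rw [map_add]
    exact Submodule.add_mem_sup (hxV φ) (hyW φ)

theorem exists_fg_forall_sliceLeft_sliceRight_mem (x : (M ⊗[k] N) ⊗[k] P) :
    ∃ W : Submodule k N, W.FG ∧
      ∀ (φ : M →ₗ[k] k) (ψ : P →ₗ[k] k), sliceLeft φ (sliceRight ψ x) ∈ W := by
  induction x with
  | zero => exact ⟨⊥, Submodule.fg_bot, fun φ ψ => by simp⟩
  | tmul y p =>
    obtain ⟨W, hW, hyW⟩ := exists_fg_forall_sliceLeft_mem y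
    refine ⟨W, hW, fun φ ψ => ?_⟩
    rw [sliceRight_tmul, map_smul]
    exact W.smul_mem _ (hyW φ)
  | add x y hx hy =>
    obtain ⟨V, hV, hxV⟩ := hx
    obtain ⟨W, hW, hyW⟩ := hy
    refine ⟨V ⊔ W, hV.sup hW, fun φ ψ => ?_⟩
    rw [map_add, map_add]
    exact Submodule.add_mem_sup (hxV φ ψ) (hyW φ ψ)

theorem sliceRight_assoc (φ : N →ₗ[k] k) (ψ : P →ₗ[k] k) (x : (M ⊗[k] N) ⊗[k] P) :
    sliceRight (LinearMap.mul' k k ∘ₗ TensorProduct.map φ ψ) (TensorProduct.assoc k M N P x) =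
      sliceRight φ (sliceRight ψ x) := by
  suffices sliceRight (LinearMap.mul' k k ∘ₗ TensorProduct.map φ ψ) ∘ₗ
      (TensorProduct.assoc k M N P).toLinearMap = sliceRight φ ∘ₗ sliceRight ψ from
    LinearMap.congr_fun this x
  ext m n p
  simp [smul_smul, mul_comm]

theorem sliceLeft_assoc_symm (φ : M →ₗ[k] k) (ψ : N →ₗ[k] k) (x : M ⊗[k] (N ⊗[k] P)) :
    sliceLeft (LinearMap.mul' k k ∘ₗ TensorProduct.map φ ψ)
        ((TensorProduct.assoc k M N P).symm x) =
      sliceLeft ψ (sliceLeft φ x) := by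
  suffices sliceLeft (LinearMap.mul' k k ∘ₗ TensorProduct.map φ ψ) ∘ₗ
      (TensorProduct.assoc k M N P).symm.toLinearMap = sliceLeft ψ ∘ₗ sliceLeft φ from
    LinearMap.congr_fun this x
  ext m n p
  simp [smul_smul]

theorem sliceRight_sliceLeft_assoc (φ : M →ₗ[k] k) (ψ : P →ₗ[k] k) (x : (M ⊗[k] N) ⊗[k] P) :
    sliceRight ψ (sliceLeft φ (TensorProduct.assoc k M N P x)) =
      sliceLeft φ (sliceRight ψ x) := by
  suffices sliceRight ψ ∘ₗ sliceLeft φ ∘ₗ (TensorProduct.assoc k M N P).toLinearMap =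
      sliceLeft φ ∘ₗ sliceRight ψ from LinearMap.congr_fun this x
  ext m n p
  simp [smul_smul, mul_comm]

variable [AddCommGroup C] [Module k C] [Coalgebra k C]

open Coalgebra

/-- The left action `c ↦ c₁ ψ(c₂)` of the dual algebra on a coalgebra. -/
noncomputable def actRight (ψ : C →ₗ[k] k) : C →ₗ[k] C := sliceRight ψ ∘ₗ comul

/-- The right action `c ↦ φ(c₁) c₂` of the dual algebra on a coalgebra. -/
noncomputable def actLeft (φ : C →ₗ[k] k) : C →ₗ[k] C := sliceLeft φ ∘ₗ comul

theorem actRight_counit (c : C) : actRight (counit (R := k)) c = c := by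
  simp [actRight, sliceRight]

theorem actLeft_counit (c : C) : actLeft (counit (R := k)) c = c := by
  simp [actLeft, sliceLeft]

theorem comul_sliceRight (ψ : C →ₗ[k] k) (x : C ⊗[k] C) :
    comul (sliceRight ψ x) = sliceRight ψ (comul.rTensor C x) :=
  (sliceRight_map ψ comul .id x).symm

theorem comul_sliceLeft (φ : C →ₗ[k] k) (x : C ⊗[k] C) :
    comul (sliceLeft φ x) = sliceLeft φ (comul.lTensor C x) :=
  (sliceLeft_map φ .id comul x).symm

theorem actRight_actRight (φ ψ : C →ₗ[k] k) (c : C) :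
    actRight φ (actRight ψ c) =
      actRight (LinearMap.mul' k k ∘ₗ TensorProduct.map φ ψ ∘ₗ comul) c := by
  simp only [actRight, LinearMap.comp_apply]
  rw [comul_sliceRight, ← sliceRight_assoc, coassoc_apply]
  exact sliceRight_map _ .id comul _

theorem actLeft_actLeft (φ ψ : C →ₗ[k] k) (c : C) :
    actLeft ψ (actLeft φ c) =
      actLeft (LinearMap.mul' k k ∘ₗ TensorProduct.map φ ψ ∘ₗ comul) c := by
  simp only [actLeft, LinearMap.comp_apply]
  rw [comul_sliceLeft, ← sliceLeft_assoc_symm, coassoc_symm_apply]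
  exact sliceLeft_map _ comul .id _

theorem actRight_actLeft (φ ψ : C →ₗ[k] k) (c : C) :
    actRight ψ (actLeft φ c) = actLeft φ (actRight ψ c) := by
  simp only [actRight, actLeft, LinearMap.comp_apply]
  rw [comul_sliceLeft, comul_sliceRight, ← sliceRight_sliceLeft_assoc, coassoc_apply]

end Actions

section Subcoalgebra

variable {k C : Type*} [Field k] [AddCommGroup C] [Module k C] [Coalgebra k C]

open Coalgebra

/-- A subcoalgebra: a subspace `V` with `Δ(V) ⊆ V ⊗ V`. -/
def IsSubcoalgebra (V : Submodule k C) : Prop :=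
  ∀ v ∈ V, comul (R := k) v ∈ LinearMap.range (TensorProduct.mapIncl V V)

theorem isSubcoalgebra_iff {V : Submodule k C} : IsSubcoalgebra V ↔
    (∀ ψ : C →ₗ[k] k, V ≤ V.comap (actRight ψ)) ∧ ∀ φ : C →ₗ[k] k, V ≤ V.comap (actLeft φ) :=
  ⟨fun h => ⟨fun ψ _ hv => (mem_range_mapIncl_iff_forall_slice_mem.1 (h _ hv)).1 ψ,
    fun φ _ hv => (mem_range_mapIncl_iff_forall_slice_mem.1 (h _ hv)).2 φ⟩,
  fun h _ hv => mem_range_mapIncl_iff_forall_slice_mem.2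
    ⟨fun ψ => h.1 ψ hv, fun φ => h.2 φ hv⟩⟩

/-- The subcoalgebra generated by an element. -/
def subcoalgebraSpan (k : Type*) [Field k] [Module k C] [Coalgebra k C] (c : C) : Submodule k C :=
  Submodule.span k (Set.range fun p : (C →ₗ[k] k) × (C →ₗ[k] k) => actLeft p.1 (actRight p.2 c))

theorem mem_subcoalgebraSpan_self (c : C) : c ∈ subcoalgebraSpan k c :=
  Submodule.subset_span ⟨(counit, counit), by simp only [actRight_counit, actLeft_counit]⟩

theorem isSubcoalgebra_subcoalgebraSpan (c : C) : IsSubcoalgebra (subcoalgebraSpan k c) := by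
  refine isSubcoalgebra_iff.2 ⟨fun χ => ?_, fun χ => ?_⟩
  all_goals
    rw [subcoalgebraSpan, Submodule.span_le]
    rintro _ ⟨⟨φ, ψ⟩, rfl⟩
    refine Submodule.subset_span ?_
  · rw [actRight_actLeft, actRight_actRight]
    exact ⟨(φ, _), rfl⟩
  · rw [actLeft_actLeft]
    exact ⟨(_, ψ), rfl⟩

theorem subcoalgebraSpan_le {W : Submodule k C} (hW : IsSubcoalgebra W) {c : C} (hc : c ∈ W) :
    subcoalgebraSpan k c ≤ W := by
  rw [isSubcoalgebra_iff] at hW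
  rw [subcoalgebraSpan, Submodule.span_le]
  rintro _ ⟨⟨φ, ψ⟩, rfl⟩
  exact hW.2 φ (hW.1 ψ hc)

theorem fg_subcoalgebraSpan (c : C) : (subcoalgebraSpan k c).FG := by
  obtain ⟨W, hW, hcW⟩ := exists_fg_forall_sliceLeft_sliceRight_mem
    (comul.rTensor C (comul (R := k) c))
  refine Submodule.FG.of_le hW (Submodule.span_le.2 ?_)
  rintro _ ⟨⟨φ, ψ⟩, rfl⟩
  simpa only [actLeft, actRight, LinearMap.comp_apply, comul_sliceRight, SetLike.mem_coe]
    using hcW φ ψ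

end Subcoalgebra

section FinitelyGenerated

variable {k H : Type*} [Field k] [CommRing H] [HopfAlgebra k H]

namespace IsHopfSubalgebra

theorem of_adjoin {s : Set H}
    (comul_mem : ∀ h ∈ s, Bialgebra.comulAlgHom k H h ∈
      tensorSubalgebra (Algebra.adjoin k s) (Algebra.adjoin k s))
    (antipode_mem : ∀ h ∈ s, HopfAlgebra.antipodeAlgHom k H h ∈ Algebra.adjoin k s) :
    IsHopfSubalgebra (Algebra.adjoin k s) where
  comul_mem := by
    suffices Algebra.adjoin k s ≤ (tensorSubalgebra (Algebra.adjoin k s)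
      (Algebra.adjoin k s)).comap (Bialgebra.comulAlgHom k H) from this
    exact Algebra.adjoin_le comul_mem
  antipode_mem := by
    suffices Algebra.adjoin k s ≤ (Algebra.adjoin k s).comap (HopfAlgebra.antipodeAlgHom k H) from
      this
    exact Algebra.adjoin_le antipode_mem

theorem isSubcoalgebra_toSubmodule (K : Subalgebra k H) [IsHopfSubalgebra K] :
    IsSubcoalgebra (Subalgebra.toSubmodule K) := comul_mem

theorem adjoin_union_antipode {V : Submodule k H} (hV : IsSubcoalgebra V) :
    IsHopfSubalgebra (Algebra.adjoin k (V ∪ HopfAlgebra.antipodeAlgHom k H '' V : Set H)) := by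
  set S := HopfAlgebra.antipodeAlgHom k H
  set K := Algebra.adjoin k (V ∪ S '' V : Set H)
  have V_le {v : H} (hv : v ∈ V) : v ∈ K := Algebra.subset_adjoin (Or.inl hv)
  have antipode_V_le {v : H} (hv : v ∈ V) : S v ∈ K := Algebra.subset_adjoin (Or.inr ⟨v, hv, rfl⟩)
  have comul_antipode (v : H) : Bialgebra.comulAlgHom k H (S v) = Algebra.TensorProduct.map S S
      (Algebra.TensorProduct.comm k H H (Bialgebra.comulAlgHom k H v)) :=
    DFunLike.congr_fun comulAlgHom_comp_antipodeAlgHom v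
  refine of_adjoin ?_ ?_
  · rintro _ (hv | ⟨v, hv, rfl⟩)
    · obtain ⟨y, hy⟩ := hV _ hv
      rw [Bialgebra.comulAlgHom_apply, ← hy]
      have V_le_toSubmodule : V ≤ Subalgebra.toSubmodule K := fun _ => V_le
      exact TensorProduct.range_mapIncl_mono V_le_toSubmodule V_le_toSubmodule ⟨y, rfl⟩
    · obtain ⟨y, hy⟩ := hV _ hv
      rw [comul_antipode, Bialgebra.comulAlgHom_apply, ← hy]
      clear hy
      induction y with
      | zero => simp only [map_zero, zero_mem]
      | tmul v w => exact tmul_mem_tensorSubalgebra (antipode_V_le w.2) (antipode_V_le v.2)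
      | add y z hy hz => simpa only [map_add] using add_mem hy hz
  · rintro _ (hv | ⟨v, hv, rfl⟩)
    · exact antipode_V_le hv
    · rw [show S (S v) = v from DFunLike.congr_fun antipodeAlgHom_comp_antipodeAlgHom v]
      exact V_le hv

theorem fg_adjoin_union_antipode {V : Submodule k H} (hV : V.FG) :
    (Algebra.adjoin k (V ∪ HopfAlgebra.antipodeAlgHom k H '' V : Set H)).FG := by
  obtain ⟨s, rfl⟩ := hV
  have fg_adjoin_span : (Algebra.adjoin k (Submodule.span k (s : Set H) : Set H)).FG :=
    ⟨s, (Algebra.adjoin_span k).symm⟩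
  rw [Algebra.adjoin_union, ← AlgHom.map_adjoin]
  exact fg_adjoin_span.sup (fg_adjoin_span.map _)

theorem exists_fg_mem {K : Subalgebra k H} [IsHopfSubalgebra K] {h : H} (hh : h ∈ K) :
    ∃ L ≤ K, IsHopfSubalgebra L ∧ L.FG ∧ h ∈ L := by
  have V_le : subcoalgebraSpan k h ≤ Subalgebra.toSubmodule K :=
    subcoalgebraSpan_le (isSubcoalgebra_toSubmodule K) hh
  refine ⟨_, Algebra.adjoin_le ?_, adjoin_union_antipode (isSubcoalgebra_subcoalgebraSpan h),
    fg_adjoin_union_antipode (fg_subcoalgebraSpan h),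
    Algebra.subset_adjoin (Or.inl (mem_subcoalgebraSpan_self h))⟩
  rintro _ (hv | ⟨v, hv, rfl⟩)
  · exact V_le hv
  · exact antipode_mem _ (V_le hv)

theorem exists_fg_finset_subset {K : Subalgebra k H} [IsHopfSubalgebra K] {s : Finset H}
    (hs : (s : Set H) ⊆ K) :
    ∃ L ≤ K, IsHopfSubalgebra L ∧ L.FG ∧ (s : Set H) ⊆ L := by
  classical
  induction s using Finset.induction_on with
  | empty => exact ⟨⊥, bot_le, inferInstance, Subalgebra.fg_bot, by simp⟩
  | insert h s _ ih =>
    rw [Finset.coe_insert, Set.insert_subset_iff] at hs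
    obtain ⟨L, hLK, _, hL, hsL⟩ := ih hs.2
    obtain ⟨M, hMK, _, hM, hhM⟩ := exists_fg_mem hs.1
    refine ⟨L ⊔ M, sup_le hLK hMK, inferInstance, hL.sup hM, ?_⟩
    rw [Finset.coe_insert, Set.insert_subset_iff]
    exact ⟨(le_sup_right : M ≤ L ⊔ M) hhM, hsL.trans (le_sup_left : L ≤ L ⊔ M)⟩

end IsHopfSubalgebra

end FinitelyGenerated

section FunctorOfPoints

open WithConv

namespace ComoduleAlgebra

variable {k H A R S : Type*} [CommRing k] [CommRing H] [Bialgebra k H] [CommRing A] [Algebra k A]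
  [CommRing R] [Algebra k R] [CommRing S] [Algebra k S] (ρ : ComoduleAlgebra k H A)

/-- The right action `X(R) × G(R) → X(R)` on points of `X = Spec A` and `G = Spec H` that
corresponds to a coaction of `H` on `A`. -/
noncomputable def act (x : A →ₐ[k] R) (g : WithConv (H →ₐ[k] R)) : A →ₐ[k] R :=
  (Algebra.TensorProduct.productMap x g.ofConv).comp ρ.coact

theorem coact_eq_act : ρ.coact = ρ.act Algebra.TensorProduct.includeLeft
    (toConv Algebra.TensorProduct.includeRight) := by
  have productMap_eq_id : Algebra.TensorProduct.productMap
      (Algebra.TensorProduct.includeLeft : A →ₐ[k] A ⊗[k] H)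
      Algebra.TensorProduct.includeRight = .id k _ := by
    ext <;> simp
  exact (congrArg (AlgHom.comp · ρ.coact) productMap_eq_id).symm

theorem comp_act (f : R →ₐ[k] S) (x : A →ₐ[k] R) (g : WithConv (H →ₐ[k] R)) :
    f.comp (ρ.act x g) = ρ.act (f.comp x) (pointMap H f g) := by
  have comp_productMap : f.comp (Algebra.TensorProduct.productMap x g.ofConv) =
      Algebra.TensorProduct.productMap (f.comp x) (f.comp g.ofConv) := by
    ext <;> simp
  exact congrArg (AlgHom.comp · ρ.coact) comp_productMap

theorem act_one (x : A →ₐ[k] R) : ρ.act x 1 = x := by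
  have productMap_one : Algebra.TensorProduct.productMap x (1 : WithConv (H →ₐ[k] R)).ofConv =
      x.comp ((Algebra.TensorProduct.rid k k A).toAlgHom.comp
        (Algebra.TensorProduct.map (.id k A) (Bialgebra.counitAlgHom k H))) := by
    ext h
    · simp
    · simp [Algebra.algebraMap_eq_smul_one]
  ext a
  exact (DFunLike.congr_fun productMap_one _).trans (congrArg x (ρ.counit a))

theorem act_mul (x : A →ₐ[k] R) (g h : WithConv (H →ₐ[k] R)) :
    ρ.act x (g * h) = ρ.act (ρ.act x g) h := by
  set m := Algebra.TensorProduct.productMap x (Algebra.TensorProduct.productMap g.ofConv h.ofConv)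
  have left_side : Algebra.TensorProduct.productMap x (g * h).ofConv =
      m.comp (Algebra.TensorProduct.map (.id k A) (Bialgebra.comulAlgHom k H)) := by
    ext b
    · simp [m]
    · simp [m, AlgHom.convMul_apply, Algebra.TensorProduct.productMap]
  have right_side : Algebra.TensorProduct.productMap (ρ.act x g) h.ofConv =
      (m.comp (Algebra.TensorProduct.assoc k k k A H H).toAlgHom).comp
        (Algebra.TensorProduct.map ρ.coact (.id k H)) := by
    have m_comp_assoc : m.comp (Algebra.TensorProduct.assoc k k k A H H).toAlgHom =
        Algebra.TensorProduct.productMap (Algebra.TensorProduct.productMap x g.ofConv)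
          h.ofConv := by
      ext <;> simp [m, Algebra.TensorProduct.one_def]
    rw [m_comp_assoc]
    ext b <;> simp [act]
  ext a
  exact (DFunLike.congr_fun left_side _).trans ((congrArg m (ρ.coassoc a)).symm.trans
    (DFunLike.congr_fun right_side _).symm)

theorem act_comp {H' A' : Type*} [CommRing H'] [Bialgebra k H'] [CommRing A'] [Algebra k A']
    {ρ' : ComoduleAlgebra k H' A'} {f : A' →ₐ[k] A} {φ : H' →ₐc[k] H}
    (colinear : ρ.coact.comp f = (Algebra.TensorProduct.map f φ).comp ρ'.coact) (x : A →ₐ[k] R)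
    (g : WithConv (H →ₐ[k] R)) :
    (ρ.act x g).comp f = ρ'.act (x.comp f) (pointComap R φ g) := by
  have productMap_comp_map : (Algebra.TensorProduct.productMap x g.ofConv).comp
      (Algebra.TensorProduct.map f (φ : H' →ₐ[k] H)) =
      Algebra.TensorProduct.productMap (x.comp f) (g.ofConv.comp φ) := by
    ext <;> simp
  rw [act, AlgHom.comp_assoc, colinear, ← AlgHom.comp_assoc, productMap_comp_map]
  rfl

theorem productMap_comp_galoisMap (x : A →ₐ[k] R) (g : WithConv (H →ₐ[k] R)) :
    (Algebra.TensorProduct.productMap x g.ofConv).comp ρ.galoisMap =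
      Algebra.TensorProduct.productMap x (ρ.act x g) := by
  ext <;> simp [galoisMap, act]

variable {ρ} (hρ : ρ.IsGaloisExtension)

include hρ

theorem IsGaloisExtension.act_injective (x : A →ₐ[k] R) : Function.Injective (ρ.act x) := by
  intro g h hgh
  have productMap_eq : Algebra.TensorProduct.productMap x g.ofConv =
      Algebra.TensorProduct.productMap x h.ofConv := by
    rw [← AlgHom.cancel_right hρ.bijective.surjective, productMap_comp_galoisMap,
      productMap_comp_galoisMap, hgh]
  rw [← ofConv_injective.eq_iff, ← Algebra.TensorProduct.productMap_right x g.ofConv,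
    productMap_eq, Algebra.TensorProduct.productMap_right]

theorem IsGaloisExtension.act_surjective (x : A →ₐ[k] R) : Function.Surjective (ρ.act x) := by
  intro y
  let γ := AlgEquiv.ofBijective ρ.galoisMap hρ.bijective
  let f : A ⊗[k] H →ₐ[k] R := (Algebra.TensorProduct.productMap x y).comp γ.symm
  have f_comp_galoisMap : f.comp ρ.galoisMap = Algebra.TensorProduct.productMap x y :=
    AlgHom.ext fun t => congrArg (Algebra.TensorProduct.productMap x y) (γ.symm_apply_apply t)
  have f_left (a : A) : f (a ⊗ₜ 1) = x a := by
    simpa [galoisMap] using DFunLike.congr_fun f_comp_galoisMap (a ⊗ₜ 1)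
  have f_eq : f = Algebra.TensorProduct.productMap x
      (f.comp Algebra.TensorProduct.includeRight) := by
    ext a
    · simpa using f_left a
    · simp
  refine ⟨toConv (f.comp Algebra.TensorProduct.includeRight), ?_⟩
  rw [← Algebra.TensorProduct.productMap_right x (ρ.act x _), ← productMap_comp_galoisMap,
    ofConv_toConv, ← f_eq, f_comp_galoisMap, Algebra.TensorProduct.productMap_right]

end ComoduleAlgebra

end FunctorOfPoints

section Triviality

open WithConv

namespace ComoduleAlgebra

variable {k H A : Type*} [CommRing k] [CommRing H] [Bialgebra k H] [CommRing A] [Algebra k A]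
  (ρ : ComoduleAlgebra k H A)

/-- The orbit map `G → X`, `g ↦ z g`, of a `k`-point `z` of `X = Spec A`, where `G = Spec H`. -/
noncomputable def orbit (z : A →ₐ[k] k) : A →ₐ[k] H :=
  ρ.act ((Algebra.ofId k H).comp z) (toConv (.id k H))

theorem comp_orbit {R : Type*} [CommRing R] [Algebra k R] (f : H →ₐ[k] R) (z : A →ₐ[k] k) :
    f.comp (ρ.orbit z) = ρ.act ((Algebra.ofId k R).comp z) (toConv f) := by
  rw [orbit, comp_act, ← AlgHom.comp_assoc,
    Subsingleton.elim (f.comp (Algebra.ofId k H)) (Algebra.ofId k R)]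
  rfl

theorem comulAlgHom_comp_orbit (z : A →ₐ[k] k) :
    (Bialgebra.comulAlgHom k H).comp (ρ.orbit z) =
      (Algebra.TensorProduct.map (ρ.orbit z) (.id k H)).comp ρ.coact := by
  have map_comp_right : pointMap H (Algebra.TensorProduct.map (ρ.orbit z) (.id k H))
      (toConv Algebra.TensorProduct.includeRight) = toConv Algebra.TensorProduct.includeRight :=
    congrArg toConv (Algebra.TensorProduct.map_comp_includeRight _ _)
  rw [comp_orbit, toConv_comulAlgHom, act_mul, ← comp_orbit, ρ.coact_eq_act, comp_act,
    Algebra.TensorProduct.map_comp_includeLeft, map_comp_right]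

variable {ρ}

theorem IsGaloisExtension.bijective_orbit (hρ : ρ.IsGaloisExtension) (z : A →ₐ[k] k) :
    Function.Bijective (ρ.orbit z) := by
  obtain ⟨β, hβ⟩ := hρ.act_surjective ((Algebra.ofId k A).comp z) (.id k A)
  have β_comp_orbit : β.ofConv.comp (ρ.orbit z) = .id k A := (ρ.comp_orbit _ z).trans hβ
  have orbit_comp_β : (ρ.orbit z).comp β.ofConv = .id k H := by
    apply toConv_injective
    apply hρ.act_injective ((Algebra.ofId k H).comp z)
    rw [← comp_orbit, AlgHom.comp_assoc, β_comp_orbit]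
    rfl
  exact ⟨Function.LeftInverse.injective (DFunLike.congr_fun β_comp_orbit),
    Function.RightInverse.surjective (DFunLike.congr_fun orbit_comp_β)⟩

theorem IsGaloisExtension.nonempty_iso_regular (hρ : ρ.IsGaloisExtension) (z : A →ₐ[k] k) :
    Nonempty (Iso ρ (regular k H)) :=
  ⟨{ toAlgEquiv := AlgEquiv.ofBijective (ρ.orbit z) (hρ.bijective_orbit z)
     colinear := DFunLike.congr_fun (ρ.comulAlgHom_comp_orbit z) }⟩

end ComoduleAlgebra

end Triviality

section CoefficientSubalgebras

namespace ComoduleAlgebra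

variable {k H A : Type*} [Field k] [CommRing H] [HopfAlgebra k H] [CommRing A] [Algebra k A]
  (ρ : ComoduleAlgebra k H A)

/-- The subalgebra `A_K = {a | ρ(a) ∈ A ⊗ K}` of a comodule algebra `A`, for a subalgebra `K` of
`H`. When `K` is a Hopf subalgebra, `Spec A_K` is the quotient of `Spec A` by the kernel of
`Spec H → Spec K`. -/
noncomputable def coeffIn (K : Subalgebra k H) : Subalgebra k A :=
  (tensorSubalgebra ⊤ K).comap ρ.coact

theorem coeffIn_mono {K L : Subalgebra k H} (hKL : K ≤ L) : ρ.coeffIn K ≤ ρ.coeffIn L :=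
  fun _ ha => tensorSubalgebra_mono le_rfl hKL ha

theorem mem_coeffIn_iff {K : Subalgebra k H} {a : A} :
    a ∈ ρ.coeffIn K ↔ ∀ φ : A →ₗ[k] k, sliceLeft φ (ρ.coact a) ∈ K :=
  mem_top_tensorSubalgebra_iff

theorem mem_coeffIn_top {ρ : ComoduleAlgebra k H A} (a : A) : a ∈ ρ.coeffIn ⊤ :=
  ρ.mem_coeffIn_iff.2 fun _ => trivial

theorem coact_sliceRight (ψ : H →ₗ[k] k) (a : A) :
    ρ.coact (sliceRight ψ (ρ.coact a)) = (actRight ψ).lTensor A (ρ.coact a) := by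
  have lTensor_sliceRight_assoc (x : (A ⊗[k] H) ⊗[k] H) :
      (sliceRight ψ).lTensor A (TensorProduct.assoc k A H H x) = sliceRight ψ x := by
    induction x with
    | zero => simp
    | tmul y h =>
      induction y with
      | zero => simp
      | tmul a g => simp
      | add y z hy hz => simp only [TensorProduct.add_tmul, map_add, hy, hz]
    | add x y hx hy => simp only [map_add, hx, hy]
  calc ρ.coact (sliceRight ψ (ρ.coact a))
      = sliceRight ψ (Algebra.TensorProduct.map ρ.coact (.id k H) (ρ.coact a)) :=
        (sliceRight_map ψ ρ.coact.toLinearMap .id _).symm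
    _ = (sliceRight ψ).lTensor A (Algebra.TensorProduct.map (.id k A)
          (Bialgebra.comulAlgHom k H) (ρ.coact a)) := by
        rw [← lTensor_sliceRight_assoc]
        exact congrArg _ (ρ.coassoc a)
    _ = (actRight ψ).lTensor A (ρ.coact a) := by
        rw [actRight, LinearMap.lTensor_comp]; rfl

theorem coact_sliceLeft {B : Type*} [CommRing B] [Algebra k B] (φ : B →ₗ[k] k) (x : B ⊗[k] A) :
    ρ.coact (sliceLeft φ x) = sliceLeft φ (Algebra.TensorProduct.map (.id k B) ρ.coact x) :=
  (sliceLeft_map φ .id ρ.coact.toLinearMap x).symm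

variable (K : Subalgebra k H) [IsHopfSubalgebra K]

theorem coact_mem_tensorSubalgebra {a : A} (ha : a ∈ ρ.coeffIn K) :
    ρ.coact a ∈ tensorSubalgebra (ρ.coeffIn K) K := by
  refine mem_tensorSubalgebra_iff.2 ⟨fun ψ => ρ.mem_coeffIn_iff.2 fun φ => ?_,
    ρ.mem_coeffIn_iff.1 ha⟩
  rw [coact_sliceRight, LinearMap.lTensor, sliceLeft_map]
  exact (isSubcoalgebra_iff.1 (IsHopfSubalgebra.isSubcoalgebra_toSubmodule K)).1 ψ
    (ρ.mem_coeffIn_iff.1 ha φ)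

/-- The coaction `A_K → A_K ⊗ K` of a Hopf subalgebra `K` of `H`. -/
noncomputable def coactRestrict : ρ.coeffIn K →ₐ[k] ρ.coeffIn K ⊗[k] K :=
  codRestrictTensor _ K (ρ.coact.comp (ρ.coeffIn K).val)
    fun a => ρ.coact_mem_tensorSubalgebra K a.2

theorem map_val_val_coactRestrict (a : ρ.coeffIn K) :
    Algebra.TensorProduct.map (ρ.coeffIn K).val K.val (ρ.coactRestrict K a) =
      ρ.coact ((ρ.coeffIn K).val a) :=
  map_val_val_codRestrictTensor _ _ a

/-- The comodule algebra `A_K` over a Hopf subalgebra `K` of `H`. -/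
noncomputable def restrict : ComoduleAlgebra k K (ρ.coeffIn K) where
  coact := ρ.coactRestrict K
  coassoc := coassoc_of_injective (f := (ρ.coeffIn K).val) Subtype.val_injective
    Subtype.val_injective (ρ.map_val_val_coactRestrict K)
    (IsHopfSubalgebra.map_val_val_comulAlgHom K) ρ.coassoc
  counit a := by
    rw [← IsHopfSubalgebra.counitAlgHom_comp_val]
    exact rid_map_counit_of_injective (f := (ρ.coeffIn K).val) Subtype.val_injective
      (ρ.map_val_val_coactRestrict K) ρ.counit a

end ComoduleAlgebra

end CoefficientSubalgebras

section TranslationMap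

open WithConv

namespace ComoduleAlgebra

variable {k H A : Type*} [CommRing k] [CommRing H] [HopfAlgebra k H] [CommRing A] [Algebra k A]
  {ρ : ComoduleAlgebra k H A} (hρ : ρ.IsGaloisExtension)

/-- The translation map of a Galois extension: the point of `Spec H` with values in `A ⊗ A` that
takes the first of the two tautological points of `Spec A` to the second. -/
noncomputable def IsGaloisExtension.translation : H →ₐ[k] A ⊗[k] A :=
  (AlgEquiv.ofBijective ρ.galoisMap hρ.bijective).symm.toAlgHom.comp
    Algebra.TensorProduct.includeRight

theorem IsGaloisExtension.galoisMap_translation (h : H) :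
    ρ.galoisMap (hρ.translation h) = 1 ⊗ₜ h :=
  (AlgEquiv.ofBijective ρ.galoisMap hρ.bijective).apply_symm_apply _

theorem IsGaloisExtension.act_translation :
    ρ.act Algebra.TensorProduct.includeLeft (toConv hρ.translation) =
      Algebra.TensorProduct.includeRight := by
  have galoisMap_comp_includeLeft : ρ.galoisMap.comp Algebra.TensorProduct.includeLeft =
      Algebra.TensorProduct.includeLeft := by
    ext; simp [galoisMap]
  have galoisMap_comp_translation : pointMap H ρ.galoisMap (toConv hρ.translation) =
      toConv Algebra.TensorProduct.includeRight :=
    congrArg toConv (AlgHom.ext hρ.galoisMap_translation)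
  rw [← AlgHom.cancel_left hρ.bijective.injective, comp_act, galoisMap_comp_includeLeft,
    galoisMap_comp_translation, ← coact_eq_act]
  ext; simp [galoisMap]

theorem IsGaloisExtension.translation_antipode (h : H) :
    hρ.translation (HopfAlgebra.antipodeAlgHom k H h) =
      Algebra.TensorProduct.comm k A A (hρ.translation h) := by
  let swap : A ⊗[k] A →ₐ[k] A ⊗[k] A := (Algebra.TensorProduct.comm k A A).toAlgHom
  have swap_left : swap.comp Algebra.TensorProduct.includeLeft =
    Algebra.TensorProduct.includeRight := by ext; simp [swap]
  have swap_right : swap.comp Algebra.TensorProduct.includeRight =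
    Algebra.TensorProduct.includeLeft := by ext; simp [swap]
  suffices toConv (hρ.translation.comp (HopfAlgebra.antipodeAlgHom k H)) =
      pointMap H swap (toConv hρ.translation) from
    DFunLike.congr_fun (congrArg ofConv this) h
  apply hρ.act_injective Algebra.TensorProduct.includeRight
  trans Algebra.TensorProduct.includeLeft
  · rw [← hρ.act_translation, ← act_mul, toConv_mul_toConv_comp_antipodeAlgHom, act_one]
  · rw [← swap_left, ← comp_act, act_translation, swap_right]

theorem IsGaloisExtension.map_coact_translation (h : H) :
    Algebra.TensorProduct.map (.id k A) ρ.coact (hρ.translation h) =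
      Algebra.TensorProduct.assoc k k k A A H
        (Algebra.TensorProduct.map hρ.translation (.id k H) (Bialgebra.comulAlgHom k H h)) := by
  let i : A ⊗[k] H →ₐ[k] A ⊗[k] (A ⊗[k] H) := Algebra.TensorProduct.includeRight
  let j : A ⊗[k] A →ₐ[k] A ⊗[k] (A ⊗[k] H) :=
    Algebra.TensorProduct.map (.id k A) Algebra.TensorProduct.includeLeft
  let f : H ⊗[k] H →ₐ[k] A ⊗[k] (A ⊗[k] H) :=
    (Algebra.TensorProduct.assoc k k k A A H).toAlgHom.comp
      (Algebra.TensorProduct.map hρ.translation (.id k H))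
  have f_left : pointMap H f (toConv Algebra.TensorProduct.includeLeft) =
      pointMap H j (toConv hρ.translation) := by
    have assoc_comp_left : (Algebra.TensorProduct.assoc k k k A A H).toAlgHom.comp
        Algebra.TensorProduct.includeLeft = j := by
      ext <;> simp [j, Algebra.TensorProduct.one_def]
    refine congrArg toConv (Eq.trans ?_ (congrArg (AlgHom.comp · hρ.translation) assoc_comp_left))
    ext; simp [f]
  have f_right : pointMap H f (toConv Algebra.TensorProduct.includeRight) =
      pointMap H i (toConv Algebra.TensorProduct.includeRight) := by
    refine congrArg toConv (AlgHom.ext fun h => ?_)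
    simp [f, i, Algebra.TensorProduct.one_def]
  have j_left : Algebra.TensorProduct.includeLeft = j.comp Algebra.TensorProduct.includeLeft := by
    ext; simp [j, Algebra.TensorProduct.one_def]
  have j_right : j.comp Algebra.TensorProduct.includeRight =
      i.comp Algebra.TensorProduct.includeLeft := by
    ext; simp [i, j]
  suffices pointMap H (Algebra.TensorProduct.map (.id k A) ρ.coact) (toConv hρ.translation) =
      pointMap H f (toConv (Bialgebra.comulAlgHom k H)) from
    DFunLike.congr_fun (congrArg ofConv this) h
  apply hρ.act_injective (Algebra.TensorProduct.includeLeft : A →ₐ[k] A ⊗[k] (A ⊗[k] H))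
  trans i.comp ρ.coact
  · rw [← Algebra.TensorProduct.map_comp_includeRight (.id k A) ρ.coact, ← hρ.act_translation,
      comp_act, Algebra.TensorProduct.map_comp_includeLeft]
    rfl
  · rw [toConv_comulAlgHom, map_mul, f_left, f_right, act_mul, j_left, ← comp_act,
      act_translation, j_right, ← comp_act, ← coact_eq_act]

end ComoduleAlgebra

end TranslationMap

section GaloisDescent

namespace ComoduleAlgebra

variable {k H A : Type*} [Field k] [CommRing H] [HopfAlgebra k H] [CommRing A] [Algebra k A]
  {ρ : ComoduleAlgebra k H A} (hρ : ρ.IsGaloisExtension)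

include hρ

namespace IsGaloisExtension

theorem sliceLeft_translation_mem (K : Subalgebra k H) [IsHopfSubalgebra K] {h : H} (hh : h ∈ K)
    (φ : A →ₗ[k] k) : sliceLeft φ (hρ.translation h) ∈ ρ.coeffIn K := by
  refine ρ.mem_coeffIn_iff.2 fun φ' => ?_
  let χ : A ⊗[k] A →ₗ[k] k := LinearMap.mul' k k ∘ₗ TensorProduct.map φ φ'
  have slice_eq : sliceLeft φ' (ρ.coact (sliceLeft φ (hρ.translation h))) =
      actLeft (χ ∘ₗ hρ.translation.toLinearMap) h := by
    rw [coact_sliceLeft, map_coact_translation, ← sliceLeft_assoc_symm]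
    refine (congrArg (sliceLeft χ) ((TensorProduct.assoc k A A H).symm_apply_apply _)).trans ?_
    exact sliceLeft_map χ hρ.translation.toLinearMap .id _
  rw [slice_eq]
  exact (isSubcoalgebra_iff.1 (IsHopfSubalgebra.isSubcoalgebra_toSubmodule K)).2 _ hh

theorem translation_mem_tensorSubalgebra (K : Subalgebra k H) [IsHopfSubalgebra K] {h : H}
    (hh : h ∈ K) : hρ.translation h ∈ tensorSubalgebra (ρ.coeffIn K) (ρ.coeffIn K) := by
  refine mem_tensorSubalgebra_iff.2 ⟨fun ψ => ?_, hρ.sliceLeft_translation_mem K hh⟩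
  have comm_translation : TensorProduct.comm k A A
      (hρ.translation (HopfAlgebra.antipodeAlgHom k H h)) = hρ.translation h := by
    rw [translation_antipode]
    exact (TensorProduct.comm k A A).symm_apply_apply (hρ.translation h)
  rw [← comm_translation, sliceRight_comm]
  exact hρ.sliceLeft_translation_mem K (IsHopfSubalgebra.antipode_mem h hh) ψ

theorem restrict (K : Subalgebra k H) [IsHopfSubalgebra K] :
    (ρ.restrict K).IsGaloisExtension where
  nontrivial := by
    have := hρ.nontrivial
    infer_instance
  bijective := by
    have galoisMap_comp_map : ρ.galoisMap.comp
        (Algebra.TensorProduct.map (ρ.coeffIn K).val (ρ.coeffIn K).val) =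
        (Algebra.TensorProduct.map (ρ.coeffIn K).val K.val).comp (ρ.restrict K).galoisMap := by
      ext a
      · simp [galoisMap]
      · simpa [galoisMap, ComoduleAlgebra.restrict, ← Algebra.TensorProduct.one_def] using
          (ρ.map_val_val_coactRestrict K a).symm
    constructor
    · refine Function.Injective.of_comp (f := Algebra.TensorProduct.map (ρ.coeffIn K).val K.val) ?_
      rw [← AlgHom.coe_comp, ← galoisMap_comp_map]
      exact hρ.bijective.injective.comp (map_val_val_injective _ _)
    · have tensorSubalgebra_le_range : tensorSubalgebra (ρ.coeffIn K) K ≤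
          (ρ.galoisMap.comp
            (Algebra.TensorProduct.map (ρ.coeffIn K).val (ρ.coeffIn K).val)).range := by
        refine tensorSubalgebra_le (fun a ha => ⟨⟨a, ha⟩ ⊗ₜ 1, by simp [galoisMap]⟩)
          fun h hh => ?_
        obtain ⟨t, ht⟩ := hρ.translation_mem_tensorSubalgebra K hh
        exact ⟨t, (congrArg ρ.galoisMap ht).trans (hρ.galoisMap_translation h)⟩
      intro y
      obtain ⟨t, ht⟩ := tensorSubalgebra_le_range ⟨y, rfl⟩
      exact ⟨t, map_val_val_injective _ _ ((DFunLike.congr_fun galoisMap_comp_map t).symm.trans ht)⟩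

theorem finiteType [Algebra.FiniteType k H] : Algebra.FiniteType k A := by
  have := hρ.nontrivial
  let γ : A ⊗[k] A →ₐ[A] A ⊗[k] H :=
    Algebra.TensorProduct.lift (Algebra.ofId A _) ρ.coact fun _ _ => Commute.all _ _
  have : Algebra.FiniteType A (A ⊗[k] A) :=
    .equiv inferInstance (AlgEquiv.ofBijective γ hρ.bijective).symm
  exact .of_finiteType_tensorProduct_of_faithfullyFlat A

theorem finiteType_coeffIn {K : Subalgebra k H} [IsHopfSubalgebra K] (hK : K.FG) :
    Algebra.FiniteType k (ρ.coeffIn K) :=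
  have : Algebra.FiniteType k K := K.fg_iff_finiteType.1 hK
  (hρ.restrict K).finiteType

theorem coeffIn_sSup_le {S : Set (Subalgebra k H)} (hS : ∀ K ∈ S, IsHopfSubalgebra K) :
    ρ.coeffIn (sSup S) ≤ ⨆ K ∈ S, ρ.coeffIn K := by
  have := hρ.nontrivial
  set B := ⨆ K ∈ S, ρ.coeffIn K
  have le_comap : sSup S ≤ (tensorSubalgebra ⊤ B).comap hρ.translation :=
    sSup_le fun K hK h hh =>
      have := hS K hK
      tensorSubalgebra_mono le_top (le_iSup₂_of_le K hK le_rfl)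
        (hρ.translation_mem_tensorSubalgebra K hh)
  intro a ha
  have one_tmul_mem : 1 ⊗ₜ a ∈ tensorSubalgebra (⊤ : Subalgebra k A) B := by
    have le_map : tensorSubalgebra ⊤ (sSup S) ≤ (tensorSubalgebra ⊤ B).map ρ.galoisMap :=
      tensorSubalgebra_le
        (fun a _ => ⟨a ⊗ₜ 1, tmul_mem_tensorSubalgebra trivial (one_mem _), by simp [galoisMap]⟩)
        fun h hh => ⟨_, le_comap hh, hρ.galoisMap_translation h⟩
    obtain ⟨t, ht, ht_eq⟩ := le_map ha
    have : ρ.galoisMap t = ρ.galoisMap (1 ⊗ₜ a) := by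
      simpa [galoisMap, ← Algebra.TensorProduct.one_def] using ht_eq
    rwa [← hρ.bijective.injective this]
  obtain ⟨φ, hφ⟩ := Module.Projective.exists_dual_eq_one k (one_ne_zero : (1 : A) ≠ 0)
  simpa [hφ] using mem_top_tensorSubalgebra_iff.1 one_tmul_mem φ

end IsGaloisExtension

end ComoduleAlgebra

end GaloisDescent

section ConstructibleSets

theorem interior_frontier_eq_empty_of_isConstructible {X : Type*} [TopologicalSpace X] {s : Set X}
    (hs : Topology.IsConstructible s) : interior (frontier s) = ∅ := by
  induction hs using BooleanSubalgebra.closure_bot_sup_induction with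
  | mem s hs => rw [← frontier_compl, interior_frontier hs.1.isClosed_compl]
  | bot => simp only [Set.bot_eq_empty, frontier_empty, interior_empty]
  | sup s _ t _ hs ht =>
    refine Set.subset_eq_empty (interior_mono ((frontier_union_subset s t).trans
      (Set.union_subset_union Set.inter_subset_left Set.inter_subset_right))) ?_
    rw [interior_union_isClosed_of_interior_empty isClosed_frontier ht, hs]
  | compl s _ hs => rwa [frontier_compl]

theorem dense_interior_of_isConstructible {X : Type*} [TopologicalSpace X] {s : Set X}
    (hs : Topology.IsConstructible s) (hd : Dense s) : Dense (interior s) := by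
  have := interior_eq_empty_iff_dense_compl.1 (interior_frontier_eq_empty_of_isConstructible hs)
  rwa [frontier, hd.closure_eq, ← Set.compl_eq_univ_sdiff, compl_compl] at this

end ConstructibleSets

section RationalPoints

theorem algHom_eq_of_ker_le {k R : Type*} [CommRing k] [CommRing R] [Algebra k R] {p q : R →ₐ[k] k}
    (h : RingHom.ker p ≤ RingHom.ker q) : p = q := by
  ext x
  have sub_mem : x - algebraMap k R (p x) ∈ RingHom.ker p := by simp [RingHom.mem_ker]
  have map_sub_eq_zero := RingHom.mem_ker.1 (h sub_mem)
  rw [map_sub, AlgHom.commutes] at map_sub_eq_zero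
  exact (sub_eq_zero.1 map_sub_eq_zero).symm

variable {k : Type*} [Field k]

/-- The point of `Spec R` underlying a `k`-point of `Spec R`. -/
def pointSpec {R : Type*} [CommRing R] [Algebra k R] (p : R →ₐ[k] k) : PrimeSpectrum R :=
  PrimeSpectrum.comap p.toRingHom ⊥

theorem asIdeal_pointSpec {R : Type*} [CommRing R] [Algebra k R] (p : R →ₐ[k] k) :
    (pointSpec p).asIdeal = RingHom.ker p := rfl

variable [IsAlgClosed k]

theorem exists_algHom_ker_eq_of_isMaximal {R : Type*} [CommRing R] [Algebra k R]
    [Algebra.FiniteType k R] (m : Ideal R) [m.IsMaximal] :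
    ∃ p : R →ₐ[k] k, RingHom.ker p = m := by
  let := Ideal.Quotient.field m
  have : Module.Finite k (R ⧸ m) := finite_of_finite_type_of_isJacobsonRing k (R ⧸ m)
  let e : k ≃ₐ[k] R ⧸ m := AlgEquiv.ofBijective (Algebra.ofId k (R ⧸ m))
    IsAlgClosed.algebraMap_bijective_of_isIntegral
  refine ⟨e.symm.toAlgHom.comp (Ideal.Quotient.mkₐ k m), ?_⟩
  ext x
  simp [RingHom.mem_ker, Ideal.Quotient.eq_zero_iff_mem]

variable (k) in
theorem nonempty_algHom_of_finiteType (R : Type*) [CommRing R] [Nontrivial R] [Algebra k R]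
    [Algebra.FiniteType k R] : Nonempty (R →ₐ[k] k) := by
  obtain ⟨m, hm⟩ := Ideal.exists_maximal R
  obtain ⟨p, -⟩ := exists_algHom_ker_eq_of_isMaximal (k := k) m
  exact ⟨p⟩

theorem exists_pointSpec_mem {R : Type*} [CommRing R] [Algebra k R] [Algebra.FiniteType k R]
    {U : Set (PrimeSpectrum R)} (hU : IsOpen U) (nonempty : U.Nonempty) :
    ∃ p : R →ₐ[k] k, pointSpec p ∈ U := by
  have : IsJacobsonRing R := isJacobsonRing_of_finiteType (A := k)
  obtain ⟨x, hxU, hx⟩ := nonempty_inter_closedPoints nonempty hU.isLocallyClosed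
  have := (PrimeSpectrum.isClosed_singleton_iff_isMaximal x).1 (mem_closedPoints_iff.1 hx)
  obtain ⟨p, hp⟩ := exists_algHom_ker_eq_of_isMaximal (k := k) x.asIdeal
  obtain rfl : pointSpec p = x := PrimeSpectrum.ext hp
  exact ⟨p, hxU⟩

theorem exists_comp_eq_of_pointSpec_mem_range {R S : Type*} [CommRing R] [CommRing S] [Algebra k R]
    [Algebra k S] [Algebra.FiniteType k S] {i : R →ₐ[k] S} {p : R →ₐ[k] k}
    (hp : pointSpec p ∈ Set.range (PrimeSpectrum.comap i.toRingHom)) :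
    ∃ q : S →ₐ[k] k, q.comp i = p := by
  obtain ⟨P, hP⟩ := hp
  obtain ⟨m, hm, hPm⟩ := P.asIdeal.exists_le_maximal P.isPrime.ne_top
  obtain ⟨q, rfl⟩ := exists_algHom_ker_eq_of_isMaximal (k := k) m
  refine ⟨q, (algHom_eq_of_ker_le fun x hx => ?_).symm⟩
  rw [← asIdeal_pointSpec, ← hP] at hx
  exact hPm hx

theorem exists_dense_isOpen_forall_exists_comp_eq {R S : Type*} [CommRing R] [CommRing S]
    [Algebra k R] [Algebra k S] [Algebra.FiniteType k R] [Algebra.FiniteType k S] {i : R →ₐ[k] S}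
    (hi : Function.Injective i) :
    ∃ U : Set (PrimeSpectrum R), IsOpen U ∧ Dense U ∧
      ∀ p : R →ₐ[k] k, pointSpec p ∈ U → ∃ q : S →ₐ[k] k, q.comp i = p := by
  have : IsNoetherianRing R := Algebra.FiniteType.isNoetherianRing k R
  have finiteType : i.toRingHom.FiniteType := by
    refine RingHom.FiniteType.of_comp_finiteType (f := algebraMap k R) ?_
    rw [show i.toRingHom.comp (algebraMap k R) = algebraMap k S from i.comp_algebraMap]
    exact RingHom.finiteType_algebraMap.2 ‹_›
  have isConstructible := PrimeSpectrum.isConstructible_range_comap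
    (RingHom.FinitePresentation.of_finiteType.1 finiteType)
  have denseRange : DenseRange (PrimeSpectrum.comap i.toRingHom) := by
    rw [PrimeSpectrum.denseRange_comap_iff_ker_le_nilRadical,
      (RingHom.injective_iff_ker_eq_bot i.toRingHom).1 hi]
    exact bot_le
  exact ⟨_, isOpen_interior, dense_interior_of_isConstructible isConstructible denseRange,
    fun p hp => exists_comp_eq_of_pointSpec_mem_range (interior_subset hp)⟩

end RationalPoints

section Translations

open WithConv

variable {k H : Type*} [CommRing k] [CommRing H] [HopfAlgebra k H]

/-- Left translation by a `k`-point `g` of `G = Spec H`, as an endomorphism of the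
coordinate ring. -/
noncomputable def leftTranslation (g : WithConv (H →ₐ[k] k)) : H →ₐ[k] H :=
  (pointMap H (Algebra.ofId k H) g * toConv (AlgHom.id k H)).ofConv

theorem toConv_comp_leftTranslation {R : Type*} [CommRing R] [Algebra k R] (f : H →ₐ[k] R)
    (g : WithConv (H →ₐ[k] k)) :
    toConv (f.comp (leftTranslation g)) = pointMap H (Algebra.ofId k R) g * toConv f :=
  calc toConv (f.comp (leftTranslation g))
      = pointMap H f (pointMap H (Algebra.ofId k H) g) * pointMap H f (toConv (.id k H)) :=
        map_mul (pointMap H f) _ _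
    _ = pointMap H (Algebra.ofId k R) g * toConv f := by
      rw [← Subsingleton.elim (f.comp (Algebra.ofId k H)) (Algebra.ofId k R)]
      rfl

theorem leftTranslation_comp_leftTranslation_inv (g : WithConv (H →ₐ[k] k)) :
    (leftTranslation g).comp (leftTranslation g⁻¹) = .id k H := by
  apply toConv_injective
  calc toConv ((leftTranslation g).comp (leftTranslation g⁻¹))
      = pointMap H (Algebra.ofId k H) g⁻¹ *
          (pointMap H (Algebra.ofId k H) g * toConv (.id k H)) :=
        toConv_comp_leftTranslation _ _
    _ = toConv (.id k H) := by
      rw [← mul_assoc, ← map_mul, inv_mul_cancel, map_one, one_mul]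

/-- Left translation by a `k`-point, as a homeomorphism of the spectrum. -/
noncomputable def leftTranslationHomeomorph (g : WithConv (H →ₐ[k] k)) :
    PrimeSpectrum H ≃ₜ PrimeSpectrum H :=
  PrimeSpectrum.homeomorphOfRingEquiv (AlgEquiv.ofAlgHom (leftTranslation g⁻¹) (leftTranslation g)
    (by simpa using leftTranslation_comp_leftTranslation_inv g⁻¹)
    (leftTranslation_comp_leftTranslation_inv g)).toRingEquiv

theorem leftTranslationHomeomorph_pointSpec {k H : Type*} [Field k] [CommRing H] [HopfAlgebra k H]
    (g : WithConv (H →ₐ[k] k)) (p : WithConv (H →ₐ[k] k)) :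
    leftTranslationHomeomorph g (pointSpec p.ofConv) = pointSpec (g * p).ofConv := by
  have comp_eq : toConv (p.ofConv.comp (leftTranslation g)) = g * p :=
    toConv_comp_leftTranslation p.ofConv g
  rw [← comp_eq]
  rfl

end Translations

section SurjectivityOnPoints

open WithConv

variable {k H K : Type*} [Field k] [IsAlgClosed k] [CommRing H] [HopfAlgebra k H]
  [Algebra.FiniteType k H]

theorem exists_pointSpec_mem_and_pointSpec_mul_mem {U : Set (PrimeSpectrum H)} (hU : IsOpen U)
    (dense : Dense U) (g : WithConv (H →ₐ[k] k)) :
    ∃ p : WithConv (H →ₐ[k] k), pointSpec p.ofConv ∈ U ∧ pointSpec (g * p).ofConv ∈ U := by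
  let τ := leftTranslationHomeomorph g
  have : Nontrivial H := (Bialgebra.counitAlgHom k H).toRingHom.domain_nontrivial
  obtain ⟨p, hp, hgp⟩ := exists_pointSpec_mem (k := k) (hU.inter (hU.preimage τ.continuous))
    (dense.inter_of_isOpen_left (dense.preimage τ.isOpenMap) hU).nonempty
  refine ⟨toConv p, hp, ?_⟩
  rwa [← leftTranslationHomeomorph_pointSpec]

theorem pointComap_surjective_of_injective [CommRing K] [HopfAlgebra k K] [Algebra.FiniteType k K]
    (φ : H →ₐc[k] K) (hφ : Function.Injective φ) : Function.Surjective (pointComap k φ) := by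
  intro g
  obtain ⟨U, hU, dense, exists_lift⟩ :=
    exists_dense_isOpen_forall_exists_comp_eq (k := k) (i := (φ : H →ₐ[k] K)) hφ
  obtain ⟨p, hp, hgp⟩ := exists_pointSpec_mem_and_pointSpec_mul_mem hU dense g
  obtain ⟨p', hp'⟩ := exists_lift _ hp
  obtain ⟨q', hq'⟩ := exists_lift _ hgp
  refine ⟨toConv q' * (toConv p')⁻¹, ?_⟩
  have map_p' : pointComap k φ (toConv p') = p := congrArg toConv hp'
  have map_q' : pointComap k φ (toConv q') = g * p := congrArg toConv hq'
  rw [map_mul, map_inv, map_p', map_q', mul_inv_cancel_right]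

end SurjectivityOnPoints

section PointExtension

open WithConv

variable {k H A : Type*} [Field k] [CommRing H] [CommRing A] [Algebra k A]

theorem exists_algHom_sup_comp_inclusion_eq [IsAlgClosed k] {B C : Subalgebra k A}
    [Algebra.FiniteType k C] {x : B →ₐ[k] k} (hx : (RingHom.ker x).map B.val ≠ ⊤) :
    ∃ y : ↥(B ⊔ C) →ₐ[k] k, y.comp (Subalgebra.inclusion le_sup_left) = x := by
  set I : Ideal A := (RingHom.ker x).map B.val
  have : Nontrivial (A ⧸ I) := Ideal.Quotient.nontrivial_iff.2 hx
  let π := Ideal.Quotient.mkₐ k I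
  have π_apply (b : B) : π b = algebraMap k _ (x b) := by
    have sub_mem : b - algebraMap k B (x b) ∈ RingHom.ker x := by simp [RingHom.mem_ker]
    rw [← π.commutes]
    exact Ideal.Quotient.eq.2 (by simpa using Ideal.mem_map_of_mem B.val sub_mem)
  have : Algebra.FiniteType k (π.comp C.val).range :=
    .of_surjective _ (π.comp C.val).rangeRestrict_surjective
  obtain ⟨r⟩ := nonempty_algHom_of_finiteType k (π.comp C.val).range
  have sup_le_comap : B ⊔ C ≤ (π.comp C.val).range.comap π := by
    refine sup_le (fun b hb => ?_) fun c hc => ⟨⟨c, hc⟩, rfl⟩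
    rw [Subalgebra.mem_comap, π_apply ⟨b, hb⟩]
    exact Subalgebra.algebraMap_mem _ _
  refine ⟨r.comp ((π.comp (B ⊔ C).val).codRestrict _ fun a => sup_le_comap a.2), ?_⟩
  ext b
  exact (congrArg r (Subtype.ext (π_apply b))).trans (r.commutes _)

namespace ComoduleAlgebra

variable [HopfAlgebra k H] {ρ : ComoduleAlgebra k H A} {K L : Subalgebra k H} [IsHopfSubalgebra K]

theorem coact_comp_inclusion [IsHopfSubalgebra L] (hKL : K ≤ L) :
    (ρ.restrict L).coact.comp (Subalgebra.inclusion (ρ.coeffIn_mono hKL)) =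
      (Algebra.TensorProduct.map (Subalgebra.inclusion (ρ.coeffIn_mono hKL))
        (IsHopfSubalgebra.inclusion hKL)).comp (ρ.restrict K).coact := by
  have map_comp_map : (Algebra.TensorProduct.map (ρ.coeffIn L).val L.val).comp
      (Algebra.TensorProduct.map (Subalgebra.inclusion (ρ.coeffIn_mono hKL))
        (IsHopfSubalgebra.inclusion hKL)) =
      Algebra.TensorProduct.map (ρ.coeffIn K).val K.val := by
    ext <;> rfl
  refine AlgHom.ext fun a => map_val_val_injective _ _ ?_
  calc _ = ρ.coact a := ρ.map_val_val_coactRestrict L _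
    _ = _ := (ρ.map_val_val_coactRestrict K a).symm
    _ = _ := (DFunLike.congr_fun map_comp_map _).symm

theorem exists_fg_finset_subset_coeffIn {s : Finset A} (hs : (s : Set A) ⊆ ρ.coeffIn K) :
    ∃ L ≤ K, IsHopfSubalgebra L ∧ L.FG ∧ (s : Set A) ⊆ ρ.coeffIn L := by
  classical
  choose t t_subset mem_of_subset using
    fun a : s => exists_finset_mem_tensorSubalgebra (hs a.2)
  obtain ⟨L, hLK, hL, fg, t_subset_L⟩ := IsHopfSubalgebra.exists_fg_finset_subset
    (K := K) (s := s.attach.biUnion t) (by simpa using fun a ha => t_subset ⟨a, ha⟩)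
  refine ⟨L, hLK, hL, fg, fun a ha => mem_of_subset ⟨a, ha⟩ L fun h hh => t_subset_L ?_⟩
  exact Finset.mem_biUnion.2 ⟨⟨a, ha⟩, Finset.mem_attach _ _, hh⟩

namespace IsGaloisExtension

variable (hρ : ρ.IsGaloisExtension)

include hρ

theorem coeffIn_sup_le [IsHopfSubalgebra L] : ρ.coeffIn (K ⊔ L) ≤ ρ.coeffIn K ⊔ ρ.coeffIn L := by
  rw [← sSup_pair, ← iSup_pair]
  exact hρ.coeffIn_sSup_le (by rintro _ (rfl | rfl) <;> infer_instance)

variable [IsAlgClosed k]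

theorem exists_comp_inclusion_eq_of_fg [IsHopfSubalgebra L] (hK : K.FG) (hL : L.FG) (hKL : K ≤ L)
    (x : ρ.coeffIn K →ₐ[k] k) :
    ∃ y : ρ.coeffIn L →ₐ[k] k, y.comp (Subalgebra.inclusion (ρ.coeffIn_mono hKL)) = x := by
  have := hρ.nontrivial
  have := hρ.finiteType_coeffIn hL
  have : Algebra.FiniteType k K := K.fg_iff_finiteType.1 hK
  have : Algebra.FiniteType k L := L.fg_iff_finiteType.1 hL
  obtain ⟨y⟩ := nonempty_algHom_of_finiteType k (ρ.coeffIn L)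
  obtain ⟨g, hg⟩ := (hρ.restrict K).act_surjective
    (y.comp (Subalgebra.inclusion (ρ.coeffIn_mono hKL))) x
  obtain ⟨g', rfl⟩ := pointComap_surjective_of_injective (IsHopfSubalgebra.inclusion hKL)
    (Subalgebra.inclusion_injective hKL) g
  exact ⟨(ρ.restrict L).act y g',
    ((ρ.restrict L).act_comp (coact_comp_inclusion hKL) y g').trans hg⟩

theorem map_ker_ne_top (x : ρ.coeffIn K →ₐ[k] k) :
    (RingHom.ker x).map (ρ.coeffIn K).val ≠ ⊤ := by
  -- An equation `1 = ∑ c b` with all `b ∈ ker x` takes place in `A_L` for some finitely generated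
  -- `L`, where it contradicts the existence of a point compatible with `x`.
  classical
  intro eq_top
  obtain ⟨t, ht, one_mem_span⟩ :=
    Submodule.mem_span_finite_of_mem_span ((Ideal.eq_top_iff_one _).1 eq_top)
  obtain ⟨c, -, sum_eq_one⟩ := Submodule.mem_span_finset.1 one_mem_span
  have t_subset : (t : Set A) ⊆ ρ.coeffIn K := fun a ha => by
    obtain ⟨b, -, rfl⟩ := ht ha
    exact b.2
  obtain ⟨K₀, hK₀K, _, hK₀, t_subset_K₀⟩ := exists_fg_finset_subset_coeffIn t_subset
  obtain ⟨L, -, _, hL, c_subset_L⟩ := exists_fg_finset_subset_coeffIn (ρ := ρ) (K := ⊤)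
    (s := t.image c) fun a _ => mem_coeffIn_top a
  obtain ⟨y, hy⟩ := hρ.exists_comp_inclusion_eq_of_fg hK₀ (hK₀.sup hL) le_sup_left
    (x.comp (Subalgebra.inclusion (ρ.coeffIn_mono hK₀K)))
  have one_mem : (1 : A) ∈ ((RingHom.ker y).restrictScalars k).map
      (ρ.coeffIn (K₀ ⊔ L)).val.toLinearMap := by
    rw [← sum_eq_one]
    refine Submodule.sum_mem _ fun a ha => ?_
    obtain ⟨b, hb, rfl⟩ := ht ha
    have y_b : y ⟨b, ρ.coeffIn_mono le_sup_left (t_subset_K₀ ha)⟩ = 0 := by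
      have x_b : x b = 0 := hb
      rw [← x_b]
      exact DFunLike.congr_fun hy ⟨(b : A), t_subset_K₀ ha⟩
    exact ⟨⟨c b, ρ.coeffIn_mono le_sup_right (c_subset_L (Finset.mem_image_of_mem c ha))⟩ *
      ⟨b, ρ.coeffIn_mono le_sup_left (t_subset_K₀ ha)⟩, Ideal.mul_mem_left _ _ y_b, rfl⟩
  obtain ⟨b, hb, b_eq_one⟩ := one_mem
  obtain rfl : b = 1 := Subtype.ext b_eq_one
  exact one_ne_zero ((map_one y).symm.trans hb)

end IsGaloisExtension

end ComoduleAlgebra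

end PointExtension

section ExistenceOfPoints

namespace ComoduleAlgebra

variable {k H A : Type*} [Field k] [CommRing H] [HopfAlgebra k H] [CommRing A] [Algebra k A]
  {ρ : ComoduleAlgebra k H A}

variable (ρ) in
/-- A `k`-point of the quotient `Spec A_K` of `Spec A`, for a variable Hopf subalgebra `K` of `H`:
an approximation to a `k`-point of `Spec A`. -/
structure PartialPoint where
  /-- The Hopf subalgebra `K`. -/
  subalgebra : Subalgebra k H
  isHopfSubalgebra : IsHopfSubalgebra subalgebra
  /-- The `k`-point of `Spec A_K`. -/
  point : ρ.coeffIn subalgebra →ₐ[k] k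

namespace PartialPoint

/-- Two partial points agree if they take the same values on the intersection of their domains. -/
def Agree (P Q : PartialPoint ρ) : Prop :=
  ∀ a (hP : a ∈ ρ.coeffIn P.subalgebra) (hQ : a ∈ ρ.coeffIn Q.subalgebra),
    P.point ⟨a, hP⟩ = Q.point ⟨a, hQ⟩

/-- Partial points are ordered by extension. -/
instance : Preorder (PartialPoint ρ) where
  le P Q := P.subalgebra ≤ Q.subalgebra ∧ Agree P Q
  le_refl P := ⟨le_rfl, fun _ _ _ => rfl⟩
  le_trans P Q R hPQ hQR := ⟨hPQ.1.trans hQR.1, fun a hP hR =>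
    (hPQ.2 a hP (ρ.coeffIn_mono hPQ.1 hP)).trans (hQR.2 a (ρ.coeffIn_mono hPQ.1 hP) hR)⟩

theorem agree_of_isChain {c : Set (PartialPoint ρ)} (hc : IsChain (· ≤ ·) c) {P Q : PartialPoint ρ}
    (hP : P ∈ c) (hQ : Q ∈ c) : Agree P Q :=
  (hc.total hP hQ).elim (fun h => h.2) fun h a haP haQ => (h.2 a haQ haP).symm

theorem bddAbove_of_isChain (hρ : ρ.IsGaloisExtension) {c : Set (PartialPoint ρ)}
    (hc : IsChain (· ≤ ·) c) (nonempty : c.Nonempty) : BddAbove c := by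
  have := nonempty.to_subtype
  have directed : Directed (· ≤ ·) fun P : c => ρ.coeffIn P.1.subalgebra := fun P Q =>
    (hc.total P.2 Q.2).elim (fun h => ⟨Q, ρ.coeffIn_mono h.1, le_rfl⟩)
      fun h => ⟨P, le_rfl, ρ.coeffIn_mono h.1⟩
  have isHopfSubalgebra : ∀ K ∈ subalgebra '' c, IsHopfSubalgebra K := by
    rintro _ ⟨P, -, rfl⟩
    exact P.isHopfSubalgebra
  have coeffIn_le : ρ.coeffIn (sSup (subalgebra '' c)) ≤ ⨆ P : c, ρ.coeffIn P.1.subalgebra := by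
    simpa only [iSup_image, iSup_subtype'] using hρ.coeffIn_sSup_le isHopfSubalgebra
  have compatible (P Q : c) (h : ρ.coeffIn P.1.subalgebra ≤ ρ.coeffIn Q.1.subalgebra) :
      P.1.point = Q.1.point.comp (Subalgebra.inclusion h) :=
    AlgHom.ext fun a => agree_of_isChain hc P.2 Q.2 a a.2 (h a.2)
  let x := Subalgebra.iSupLift _ directed (fun P => P.1.point) compatible _ coeffIn_le
  refine ⟨⟨sSup (subalgebra '' c), .sSup isHopfSubalgebra, x⟩, fun P hP =>
    ⟨le_sSup ⟨P, hP, rfl⟩, fun a haP haQ => ?_⟩⟩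
  exact (Subalgebra.iSupLift_of_mem (dir := directed) (f := fun P => P.1.point) (hf := compatible)
    (hT := coeffIn_le) (i := ⟨P, hP⟩) _ ⟨a, haQ⟩ haP).symm

variable [IsAlgClosed k]

theorem exists_le_of_fg (hρ : ρ.IsGaloisExtension) (P : PartialPoint ρ) {F : Subalgebra k H}
    [IsHopfSubalgebra F] (hF : F.FG) : ∃ Q : PartialPoint ρ, P ≤ Q ∧ F ≤ Q.subalgebra := by
  have := P.isHopfSubalgebra
  have := hρ.finiteType_coeffIn hF
  obtain ⟨y, hy⟩ := exists_algHom_sup_comp_inclusion_eq (C := ρ.coeffIn F)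
    (hρ.map_ker_ne_top P.point)
  exact ⟨⟨P.subalgebra ⊔ F, inferInstance, y.comp (Subalgebra.inclusion hρ.coeffIn_sup_le)⟩,
    ⟨le_sup_left, fun a ha _ => (DFunLike.congr_fun hy ⟨a, ha⟩).symm⟩, le_sup_right⟩

end PartialPoint

variable [IsAlgClosed k]

theorem IsGaloisExtension.nonempty_point (hρ : ρ.IsGaloisExtension) : Nonempty (A →ₐ[k] k) := by
  have := hρ.nontrivial
  have : Nonempty (PartialPoint ρ) := by
    have := hρ.finiteType_coeffIn (K := ⊥) Subalgebra.fg_bot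
    obtain ⟨x⟩ := nonempty_algHom_of_finiteType k (ρ.coeffIn ⊥)
    exact ⟨⟨⊥, inferInstance, x⟩⟩
  obtain ⟨P, hP⟩ := zorn_le_nonempty fun _ => PartialPoint.bddAbove_of_isChain hρ
  have eq_top : ⊤ ≤ P.subalgebra := fun h _ => by
    obtain ⟨F, -, _, hF, hhF⟩ := IsHopfSubalgebra.exists_fg_mem (k := k) (K := ⊤) (h := h) trivial
    obtain ⟨Q, hPQ, hFQ⟩ := P.exists_le_of_fg hρ hF
    exact (hP hPQ).1 (hFQ hhF)
  exact ⟨P.point.comp ((AlgHom.id k A).codRestrict _ fun a =>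
    ρ.coeffIn_mono eq_top (mem_coeffIn_top a))⟩

end ComoduleAlgebra

end ExistenceOfPoints

section ShearMap

namespace RightActionObj

variable {C : Type u} [Category.{v} C] [CartesianMonoidalCategory C] {G X : C} [MonObj G]
  (a : RightActionObj G X)

@[simp]
theorem shear_fst : a.shear ≫ fst X X = fst X G := lift_fst _ _

@[simp]
theorem shear_snd : a.shear ≫ snd X X = a.act := lift_snd _ _

/-- The orbit map `g ↦ xg` of a point `x`. -/
def orbitMap (x : 𝟙_ C ⟶ X) : G ⟶ X := lift (toUnit G ≫ x) (𝟙 G) ≫ a.act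

theorem orbitMap_equivariant (x : 𝟙_ C ⟶ X) :
    a.orbitMap x ▷ G ≫ a.act = MonObj.mul ≫ a.orbitMap x := by
  have lift_assoc_mul : lift (toUnit G ≫ x) (𝟙 G) ▷ G ≫ (α_ X G G).hom ≫ X ◁ MonObj.mul =
      MonObj.mul ≫ lift (toUnit G ≫ x) (𝟙 G) := by
    have lift_assoc_snd :
        lift (toUnit G ≫ x) (𝟙 G) ▷ G ≫ (α_ X G G).hom ≫ snd X (G ⊗ G) = 𝟙 _ := by
      ext <;> simp
    ext
    · simp
    · simp [reassoc_of% lift_assoc_snd]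
  rw [orbitMap, comp_whiskerRight, Category.assoc, a.act_mul, reassoc_of% lift_assoc_mul]

variable [IsIso a.shear]

@[simp]
theorem inv_shear_fst : inv a.shear ≫ fst X G = fst X X := by
  rw [IsIso.inv_comp_eq, shear_fst]

@[simp]
theorem inv_shear_act : inv a.shear ≫ a.act = snd X X := by
  rw [IsIso.inv_comp_eq, shear_snd]

/-- The isomorphism `(t, g) ↦ (t, x(t)g)` trivializing the base change of a torsor `X` along a
`T`-valued point `x` of `X`. -/
@[simps]
noncomputable def trivialization {T : C} (x : T ⟶ X) : T ⊗ G ≅ T ⊗ X where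
  hom := lift (fst T G) (x ▷ G ≫ a.act)
  inv := lift (fst T X) (x ▷ X ≫ inv a.shear ≫ snd X G)
  hom_inv_id := by
    have hom_whiskerRight : lift (fst T G) (x ▷ G ≫ a.act) ≫ x ▷ X = x ▷ G ≫ a.shear := by
      ext <;> simp
    ext
    · simp
    · simp [reassoc_of% hom_whiskerRight]
  inv_hom_id := by
    have inv_whiskerRight :
        lift (fst T X) (x ▷ X ≫ inv a.shear ≫ snd X G) ≫ x ▷ G = x ▷ X ≫ inv a.shear := by
      ext <;> simp
    ext
    · simp
    · simp [reassoc_of% inv_whiskerRight]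

theorem isIso_orbitMap (x : 𝟙_ C ⟶ X) : IsIso (a.orbitMap x) := by
  have lift_eq : lift (toUnit G ≫ x) (𝟙 G) = (λ_ G).inv ≫ x ▷ G := by
    ext <;> simp
  have orbitMap_eq : a.orbitMap x = ((λ_ G).symm ≪≫ a.trivialization x ≪≫ λ_ X).hom := by
    simp [orbitMap, lift_eq]
  rw [orbitMap_eq]
  infer_instance

theorem nonempty_iso_regular (x : 𝟙_ C ⟶ X) : Nonempty (a.Iso (regular G)) := by
  have := a.isIso_orbitMap x
  refine ⟨(asIso (a.orbitMap x)).symm, ?_⟩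
  rw [← cancel_epi (a.orbitMap x ▷ G), reassoc_of% a.orbitMap_equivariant x]
  simp [regular, ← comp_whiskerRight_assoc]

end RightActionObj

end ShearMap

section AffineDescent

open AlgebraicGeometry Limits

/-- The faithfully flat quasi-compact morphisms of schemes. -/
abbrev fpqcMorphisms : MorphismProperty Scheme.{u} := @Surjective ⊓ @Flat ⊓ @QuasiCompact

theorem fpqcMorphisms_of_isAffine {S T : Scheme.{u}} [IsAffine S] [IsAffine T] (f : T ⟶ S)
    [Flat f] [Surjective f] : fpqcMorphisms f :=
  ⟨⟨‹_›, ‹_›⟩, inferInstance⟩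

instance isStableUnderBaseChange_fpqcMorphisms :
    fpqcMorphisms.{u}.IsStableUnderBaseChange :=
  ⟨fun h hg => ⟨⟨MorphismProperty.of_isPullback h hg.1.1,
    MorphismProperty.of_isPullback h hg.1.2⟩, MorphismProperty.of_isPullback h hg.2⟩⟩

instance descendsAlong_quasiCompact :
    MorphismProperty.DescendsAlong (C := Scheme.{u}) @QuasiCompact fpqcMorphisms := by
  refine ⟨fun {A X Y Z fst snd f g} h hf _ => ⟨fun V hV hVc => ?_⟩⟩
  obtain ⟨⟨surjective, -⟩, _⟩ := hf
  have : Surjective snd := MorphismProperty.of_isPullback h surjective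
  have isCompact_preimage := fst.isCompact_preimage (U := f ⁻¹ᵁ ⟨V, hV⟩)
    (f.isCompact_preimage (U := ⟨V, hV⟩) hVc)
  have preimage_eq_image : g ⁻¹' V = snd '' ((fst ≫ f) ⁻¹ᵁ ⟨V, hV⟩ : A.Opens) := by
    rw [h.w]
    exact (Set.image_preimage_eq (g ⁻¹' V) snd.surjective).symm
  rw [preimage_eq_image]
  exact isCompact_preimage.image snd.continuous

instance descendsAlong_quasiSeparated :
    MorphismProperty.DescendsAlong (C := Scheme.{u}) @QuasiSeparated fpqcMorphisms := by
  let P : MorphismProperty Scheme.{u} := @QuasiCompact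
  have : P.RespectsIso := quasiCompact_isStableUnderBaseChange.respectsIso
  have : P.DescendsAlong fpqcMorphisms := descendsAlong_quasiCompact
  rw [quasiSeparated_eq_diagonal_is_quasiCompact]
  exact (inferInstance : P.diagonal.DescendsAlong fpqcMorphisms)

section Square

variable {X Y S T : Scheme.{u}} {f : T ⟶ S} {g : Y ⟶ X} {iX : X ⟶ S} {iY : Y ⟶ T}
  (h : IsPullback g iY iX f) [IsAffine S] [IsAffine T] [Flat f]

include h

theorem isPullback_specMap_appTop [QuasiCompact iX] [QuasiSeparated iX] :
    IsPullback (Spec.map iY.appTop) (Spec.map g.appTop) (Spec.map f.appTop)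
      (Spec.map iX.appTop) := by
  have : CompactSpace X := (quasiCompact_iff_compactSpace iX).1 ‹_›
  have : QuasiSeparatedSpace X := (quasiSeparated_iff_quasiSeparatedSpace iX).1 ‹_›
  have isIso_pushoutSection := isIso_pushoutSection_of_isQuasiSeparated_of_flat_right h (US := ⊤)
    (UT := ⊤) (UX := ⊤) (UY := ⊤) le_top le_top (by simp) (isAffineOpen_top S) (isAffineOpen_top T)
    isCompact_univ isQuasiSeparated_univ
  have isPushout : IsPushout iX.appTop f.appTop g.appTop iY.appTop := by
    simpa [← Scheme.Hom.appLE_eq_app] using (isIso_pushoutSection_iff ..).1 isIso_pushoutSection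
  exact isPushout.op.map Scheme.Spec

theorem isPullback_toSpecΓ [QuasiCompact iX] [QuasiSeparated iX] :
    IsPullback Y.toSpecΓ g (Spec.map g.appTop) X.toSpecΓ := by
  have outer : IsPullback g (Y.toSpecΓ ≫ Spec.map iY.appTop) (X.toSpecΓ ≫ Spec.map iX.appTop)
      (Spec.map f.appTop) :=
    .of_iso h (Iso.refl Y) (Iso.refl X) T.isoSpec S.isoSpec (by simp)
      (Scheme.toSpecΓ_naturality iY) (Scheme.toSpecΓ_naturality iX) (Scheme.toSpecΓ_naturality f)
  exact .of_right outer.flip (Scheme.toSpecΓ_naturality g).symm (isPullback_specMap_appTop h)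

theorem isAffine_of_isPullback [IsAffine Y] [Surjective f] : IsAffine X := by
  have fpqc := fpqcMorphisms_of_isAffine f
  have : QuasiCompact iX :=
    MorphismProperty.of_isPullback_of_descendsAlong h.flip fpqc (inferInstance : QuasiCompact iY)
  have : QuasiSeparated iX :=
    MorphismProperty.of_isPullback_of_descendsAlong h.flip fpqc
      (inferInstance : QuasiSeparated iY)
  obtain ⟨_, _⟩ : Flat (Spec.map f.appTop) ∧ Surjective (Spec.map f.appTop) :=
    (flat_and_surjective_SpecMap_iff _).2
      ((Flat.flat_and_surjective_iff_faithfullyFlat_of_isAffine f).1 ⟨‹_›, ‹_›⟩)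
  exact ⟨MorphismProperty.of_isPullback_of_descendsAlong
    (P := MorphismProperty.isomorphisms Scheme) (isPullback_toSpecΓ h)
    (MorphismProperty.of_isPullback (isPullback_specMap_appTop h)
      (fpqcMorphisms_of_isAffine (Spec.map f.appTop)))
    (inferInstance : IsIso Y.toSpecΓ)⟩

end Square

theorem IsTorsor.isAffine {k : Type u} [Field k] {G X : Over (Spec (CommRingCat.of k))}
    [GrpObj G] [IsAffine G.left] {a : RightActionObj G X} (ha : IsTorsor a) : IsAffine X.left := by
  have := ha.isIso_shear
  obtain ⟨x⟩ := ha.nonempty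
  obtain ⟨U, hU, hx, -⟩ :=
    exists_isAffineOpen_mem_and_subset (X := X.left) (x := x) (U := ⊤) trivial
  let T : Over (Spec (CommRingCat.of k)) := Over.mk (U.ι ≫ X.hom)
  let t : T ⟶ X := Over.homMk U.ι
  have : IsAffine T.left := hU
  have : IsAffine (pullback T.hom X.hom) := by
    have : IsAffine (T ⊗ G).left := inferInstanceAs (IsAffine (pullback T.hom G.hom))
    have : IsIso (a.trivialization t).inv.left :=
      inferInstanceAs (IsIso ((Over.forget _).map (a.trivialization t).inv))
    exact .of_isIso (a.trivialization t).inv.left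
  have : Surjective T.hom := by
    have : Subsingleton (Spec (CommRingCat.of k)) :=
      inferInstanceAs (Subsingleton (PrimeSpectrum k))
    exact ⟨fun s => ⟨⟨x, hx⟩, Subsingleton.elim _ _⟩⟩
  exact isAffine_of_isPullback (IsPullback.of_hasPullback T.hom X.hom).flip

end AffineDescent

section PreimageOfActions

namespace RightActionObj

open Functor LaxMonoidal

/-- Transport of an action along isomorphisms of the monoid and of the object acted on. -/
def ofIso {C : Type*} [Category* C] [CartesianMonoidalCategory C] {G G' X X' : C} [MonObj G]
    [MonObj G'] (a : RightActionObj G' X') (eG : G ≅ G') [IsMonHom eG.hom] (eX : X ≅ X') :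
    RightActionObj G X where
  act := (eX.hom ⊗ₘ eG.hom) ≫ a.act ≫ eX.inv
  act_one := by
    rw [whiskerLeft_comp_tensorHom_assoc, IsMonHom.one_hom, tensorHom_def_assoc,
      reassoc_of% a.act_one, rightUnitor_naturality_assoc, Iso.hom_inv_id, Category.comp_id]
  act_mul := by
    have act_act : a.act ▷ G' ≫ a.act ≫ eX.inv =
        (α_ X' G' G').hom ≫ X' ◁ MonObj.mul ≫ a.act ≫ eX.inv := by
      rw [reassoc_of% a.act_mul]
    have whiskerRight_tensorHom : ((eX.hom ⊗ₘ eG.hom) ≫ a.act ≫ eX.inv) ▷ G ≫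
        (eX.hom ⊗ₘ eG.hom) = ((eX.hom ⊗ₘ eG.hom) ⊗ₘ eG.hom) ≫ a.act ▷ G' := by
      rw [whiskerRight_comp_tensorHom, tensorHom_comp_whiskerRight]
      simp
    rw [reassoc_of% whiskerRight_tensorHom, act_act, associator_naturality_assoc,
      whiskerLeft_comp_tensorHom_assoc, tensorHom_comp_whiskerLeft_assoc, IsMonHom.mul_hom]

theorem isIso_shear_ofIso {C : Type*} [Category* C] [CartesianMonoidalCategory C] {G G' X X' : C}
    [MonObj G] [MonObj G'] (a : RightActionObj G' X') [IsIso a.shear] (eG : G ≅ G')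
    [IsMonHom eG.hom] (eX : X ≅ X') : IsIso (a.ofIso eG eX).shear := by
  have shear_eq : (a.ofIso eG eX).shear =
      (eX.hom ⊗ₘ eG.hom) ≫ a.shear ≫ (eX.inv ⊗ₘ eX.inv) := by
    ext <;> simp [ofIso, reassoc_of% a.shear_fst, reassoc_of% a.shear_snd]
  rw [shear_eq]
  infer_instance

section FullyFaithful

variable {C : Type*} [Category* C] [CartesianMonoidalCategory C] {D : Type*} [Category* D]
  [CartesianMonoidalCategory D] {F : C ⥤ D} [F.Monoidal] (hF : F.FullyFaithful)

open scoped Obj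

/-- The action in `C` mapped to a given action by a fully faithful monoidal functor `F : C ⥤ D`. -/
noncomputable def preimage {G X : C} [MonObj G] (a : RightActionObj (F.obj G) (F.obj X)) :
    RightActionObj G X where
  act := hF.preimage (OplaxMonoidal.δ F X G ≫ a.act)
  act_one := hF.map_injective <| by
    have map_one : F.map (MonObj.one : 𝟙_ C ⟶ G) = OplaxMonoidal.η F ≫ MonObj.one := by
      rw [obj.η_def, Monoidal.η_ε_assoc]
    rw [F.map_comp, hF.map_preimage, ← OplaxMonoidal.δ_natural_right_assoc, map_one,
      MonoidalCategory.whiskerLeft_comp_assoc, a.act_one, ← OplaxMonoidal.right_unitality_hom]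
  act_mul := hF.map_injective <| by
    have map_mul : F.map (MonObj.mul : G ⊗ G ⟶ G) = OplaxMonoidal.δ F G G ≫ MonObj.mul := by
      rw [obj.μ_def, Monoidal.δ_μ_assoc]
    rw [F.map_comp, F.map_comp, F.map_comp, hF.map_preimage, ← OplaxMonoidal.δ_natural_left_assoc,
      hF.map_preimage, comp_whiskerRight_assoc, a.act_mul, ← OplaxMonoidal.δ_natural_right_assoc,
      map_mul, MonoidalCategory.whiskerLeft_comp_assoc, OplaxMonoidal.associativity_assoc]

theorem isIso_shear_preimage {G X : C} [MonObj G] (a : RightActionObj (F.obj G) (F.obj X))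
    [IsIso a.shear] : IsIso (a.preimage hF).shear := by
  have := hF.reflectsIsomorphisms
  have map_shear : F.map (a.preimage hF).shear =
      OplaxMonoidal.δ F X G ≫ a.shear ≫ LaxMonoidal.μ F X X := by
    rw [← cancel_mono (OplaxMonoidal.δ F X X)]
    ext <;> simp [preimage, ← Functor.map_comp]
  have : IsIso (F.map (a.preimage hF).shear) := by
    rw [map_shear]
    infer_instance
  exact isIso_of_reflects_iso _ F

end FullyFaithful

end RightActionObj

end PreimageOfActions

section AffineTorsors

open AlgebraicGeometry Opposite Functor

open scoped Obj

namespace RightActionObj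

section CommAlgCat

variable {k : Type u} [Field k] {H : Type u} [CommRing H] [HopfAlgebra k H]
  {A : Type u} [CommRing A] [Algebra k A]
  (a : RightActionObj (op (CommAlgCat.of k H)) (op (CommAlgCat.of k A)))

/-- The coaction on the coordinate ring of an affine scheme with an action of an affine group
scheme. -/
def comoduleAlgebra : ComoduleAlgebra k H A where
  coact := a.act.unop.hom
  coassoc x := (AlgEquiv.eq_symm_apply _).1 <| DFunLike.congr_fun congr($(a.act_mul).unop.hom) x
  counit x := (AlgEquiv.eq_symm_apply _).1 <| DFunLike.congr_fun congr($(a.act_one).unop.hom) x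

theorem isGaloisExtension_comoduleAlgebra [Nontrivial A] [IsIso a.shear] :
    a.comoduleAlgebra.IsGaloisExtension where
  nontrivial := ‹_›
  bijective := by
    have : IsIso a.shear.unop := inferInstance
    have galoisMap_eq : a.comoduleAlgebra.galoisMap = a.shear.unop.hom := rfl
    rw [galoisMap_eq]
    exact ConcreteCategory.bijective_of_isIso a.shear.unop

end CommAlgCat

theorem exists_algSpec_iso_isIso_shear {R : CommRingCat.{u}} {G X : Over (Spec R)}
    [GrpObj G] [IsAffine G.left] [IsAffine X.left] (a : RightActionObj G X) [IsIso a.shear] :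
    ∃ (H : CommHopfAlgCat.{u} R) (A : CommAlgCat.{u} R)
      (a' : RightActionObj (op (CommAlgCat.of R H)) (op (CommAlgCat.of R A))),
      IsIso a'.shear ∧ Nonempty ((algSpec R).obj (op (CommAlgCat.of R A)) ≅ X) := by
  obtain ⟨⟨H⟩, ⟨e⟩⟩ := essImage_hopfSpec (G := .mk G).2 ‹_›
  obtain ⟨⟨A⟩, ⟨eX⟩⟩ := essImage_algSpec.2 ‹IsAffine X.left›
  let eG : (algSpec R).obj (op (CommAlgCat.of R H)) ≅ G := (Grp.forget _).mapIso e
  have : IsMonHom eG.hom := e.hom.hom.isMonHom_hom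
  have := a.isIso_shear_ofIso eG eX
  exact ⟨H, A, (a.ofIso eG eX).preimage algSpec.fullyFaithful,
    isIso_shear_preimage algSpec.fullyFaithful _, ⟨eX⟩⟩

end RightActionObj

/-- The rational point of `Spec A` defined by a homomorphism from `A` to the base ring. -/
noncomputable def algSpecPoint {R : CommRingCat.{u}} {A : Type u} [CommRing A] [Algebra R A]
    (x : A →ₐ[R] R) : 𝟙_ (Over (Spec R)) ⟶ (algSpec R).obj (op (CommAlgCat.of R A)) :=
  Functor.LaxMonoidal.ε (algSpec R) ≫ (algSpec R).map (CommAlgCat.ofHom x).op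

theorem IsTorsor.nonempty_point {k : Type u} [Field k] [IsAlgClosed k]
    {G X : Over (Spec (CommRingCat.of k))} [GrpObj G] [IsAffine G.left] {a : RightActionObj G X}
    (ha : IsTorsor a) : Nonempty (𝟙_ (Over (Spec (CommRingCat.of k))) ⟶ X) := by
  have := ha.isIso_shear
  have := ha.isAffine
  obtain ⟨H, A, a', isIso_shear, ⟨e⟩⟩ := a.exists_algSpec_iso_isIso_shear
  have : Nontrivial A := by
    obtain ⟨x⟩ := ha.nonempty
    exact (e.inv.left x : PrimeSpectrum A).nontrivial
  obtain ⟨x⟩ := (a'.isGaloisExtension_comoduleAlgebra (k := k) (H := H) (A := A)).nonempty_point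
  exact ⟨algSpecPoint (R := CommRingCat.of k) x ≫ e.hom⟩

end AffineTorsors

theorem propositionA1 {k : Type u} [Field k] [IsAlgClosed k] :
    (∀ (H : Type v) [CommRing H] [HopfAlgebra k H]
        (A : Type w) [CommRing A] [Algebra k A] (ρ : ComoduleAlgebra k H A),
        ρ.IsGaloisExtension → Nonempty (ρ.Iso (ComoduleAlgebra.regular k H))) ∧
    (∀ (G : Over (AlgebraicGeometry.Spec (CommRingCat.of k))) [GrpObj G]
        [AlgebraicGeometry.IsAffine G.left]
        (X : Over (AlgebraicGeometry.Spec (CommRingCat.of k))) (a : RightActionObj G X),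
        IsTorsor a → Nonempty (a.Iso (RightActionObj.regular G))) := by
  refine ⟨fun H _ _ A _ _ ρ hρ => ?_, fun G _ _ X a ha => ?_⟩
  · obtain ⟨x⟩ := hρ.nonempty_point
    exact hρ.nonempty_iso_regular x
  · have := ha.isIso_shear
    obtain ⟨x⟩ := ha.nonempty_point
    exact a.nonempty_iso_regular x
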